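/- All vector spaces and algebras are over $\mathbb{C}$; algebras are associative and unital, and homomorphisms are unital. A Fréchet algebra is an algebra with a complete metrizable locally convex topology for which multiplication is jointly continuous; left, right and bi-modules over it are Fréchet spaces with jointly continuous unital actions. Let $\hat\otimes$ be the completed projective tensor product. For a right Fréchet $A$-module $M$ and a left Fréchet $A$-module $N$ let $M\hat\otimes_A N$ be the quotient of $M\hat\otimes N$ by the closed linear span of all $x\cdot a\otimes y-x\otimes a\cdot y$, and let $\mathrm{Tor}_n^A(M,N)$ be the $n$th homology, with its quotient topology, of $P_\bullet\hat\otimes_A N$, where $0\leftarrow M\leftarrow P_\bullet$ is a projective resolution of $M$, i.e. a complex of right Fréchet $A$-modules that has a contracting homotopy of continuous linear maps and in which every $P_n$ is projective (morphisms out of $P_n$ take admissible sequences, those that split as sequences of topological vector spaces, to exact sequences). Let $\varphi\colon A\to B$ be a continuous homomorphism of Fréchet algebras; regard $B$ as an $A$-bimodule through $\varphi$. One calls $\varphi$ *$0$-pseudoflat* if $\mathrm{Tor}_0^A(B,B)$ is Hausdorff, and an *epimorphism* if it is an epimorphism in the category of Fréchet algebras and continuous homomorphisms. Let $\mu_A\colon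 A\hat\otimes A\to A$ be the multiplication map and $\Omega^1A=\ker\mu_A$ the bimodule of noncommutative differential $1$-forms; similarly for $B$. Let $$\check\varphi\colon B\hat\otimes_A\Omega^1A\hat\otimes_A B\to\Omega^1B,\qquad b\otimes\omega\otimes c\mapsto b\cdot(\varphi\hat\otimes\varphi)(\omega)\cdot c,$$ be the canonical $B$-bimodule morphism, and let $$d_\varphi\colon B\hat\otimes A\hat\otimes B\to B\hat\otimes B,\qquad b\otimes a\otimes c\mapsto b\varphi(a)\otimes c-b\otimes\varphi(a)c .$$ **Theorem.** (1) $\varphi$ is a $0$-pseudoflat epimorphism if and only if $\check\varphi$ is surjective. (2) $\varphi$ is a $0$-pseudoflat epimorphism if and only if the sequence $$0\longleftarrow B\xleftarrow{\ \mu_B\ }B\hat\otimes B\xleftarrow{\ d_\varphi\ }B\hat\otimes A\hat\otimes B$$ is exact. -/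

import Mathlib

universe u

noncomputable section

namespace Frechet

open TensorProduct Topology Filter Set Pointwise

/-- A Fréchet space over `ℂ`: a metrizable locally convex topological vector space that is complete
(for its canonical translation-invariant uniform structure). -/
class FrechetSpace (E : Type*) [AddCommGroup E] [Module ℂ E] [TopologicalSpace E] : Prop
    extends IsTopologicalAddGroup E, ContinuousSMul ℂ E, LocallyConvexSpace ℝ E where
  metrizable : TopologicalSpace.MetrizableSpace E
  complete : @CompleteSpace E (IsTopologicalAddGroup.rightUniformSpace E)

attribute [instance] FrechetSpace.metrizable

section ProjectiveTopology

variable (M N : Type*) [AddCommGroup M] [Module ℂ M] [TopologicalSpace M]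
  [AddCommGroup N] [Module ℂ N] [TopologicalSpace N]

/-- The algebraic tensor product `M ⊗ N` over `ℂ`, to be given the projective topology. -/
def ATensor : Type _ := M ⊗[ℂ] N

instance : AddCommGroup (ATensor M N) := inferInstanceAs (AddCommGroup (M ⊗[ℂ] N))
instance : Module ℂ (ATensor M N) := inferInstanceAs (Module ℂ (M ⊗[ℂ] N))

/-- The canonical bilinear map `M × N → M ⊗ N`. -/
def ATensor.mk : M →ₗ[ℂ] N →ₗ[ℂ] ATensor M N := TensorProduct.mk ℂ M N

/-- The topologies on `M ⊗ N` that are locally convex vector space topologies and make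
the canonical bilinear map `M × N → M ⊗ N` jointly continuous. -/
def ATensor.admissibleTopologies : Set (TopologicalSpace (ATensor M N)) :=
  {t | @IsTopologicalAddGroup _ t _ ∧ @ContinuousSMul ℂ (ATensor M N) _ _ t ∧
    @LocallyConvexSpace ℝ (ATensor M N) _ _ _ _ t ∧
    @Continuous (M × N) (ATensor M N) _ t (fun p => ATensor.mk M N p.1 p.2)}

/-- The projective topology: the finest locally convex topology on `M ⊗ N` making the canonical
bilinear map jointly continuous. (In Mathlib's order on topologies, finer means smaller.) -/
instance : TopologicalSpace (ATensor M N) := sInf (ATensor.admissibleTopologies M N)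

instance : IsTopologicalAddGroup (ATensor M N) :=
  topologicalAddGroup_sInf fun _ h => h.1

instance : ContinuousSMul ℂ (ATensor M N) :=
  continuousSMul_sInf fun _ h => h.2.1

instance : LocallyConvexSpace ℝ (ATensor M N) :=
  LocallyConvexSpace.sInf fun _ h => h.2.2.1

instance : UniformSpace (ATensor M N) := IsTopologicalAddGroup.rightUniformSpace _

instance : IsUniformAddGroup (ATensor M N) := isUniformAddGroup_of_addCommGroup

theorem ATensor.continuous_mk : Continuous (fun p : M × N => ATensor.mk M N p.1 p.2) :=
  continuous_sInf_rng.2 fun _ h => h.2.2.2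

variable {M N}

set_option linter.unusedSectionVars false in
@[elab_as_elim]
theorem ATensor.induction {p : ATensor M N → Prop} (t : ATensor M N) (h0 : p 0)
    (h1 : ∀ x y, p (ATensor.mk M N x y)) (h2 : ∀ s t, p s → p t → p (s + t)) : p t :=
  TensorProduct.induction_on t h0 h1 h2

theorem ATensor.continuous_of_mk {E : Type*} [AddCommGroup E] [Module ℂ E] [TopologicalSpace E]
    [IsTopologicalAddGroup E] [ContinuousSMul ℂ E] [LocallyConvexSpace ℝ E]
    (f : ATensor M N →ₗ[ℂ] E) (hf : Continuous fun p : M × N => f (ATensor.mk M N p.1 p.2)) :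
    Continuous f := by
  rw [continuous_iff_le_induced]
  refine sInf_le ⟨topologicalAddGroup_induced f, continuousSMul_induced f,
    LocallyConvexSpace.induced (f.restrictScalars ℝ), continuous_induced_rng.2 hf⟩

end ProjectiveTopology

theorem exists_smul_mem {X : Type*} [AddCommGroup X] [Module ℂ X] [TopologicalSpace X]
    [ContinuousSMul ℂ X] (x : X) {U : Set X} (hU : U ∈ 𝓝 0) : ∃ c : ℂ, c ≠ 0 ∧ c • x ∈ U := by
  have ht : Tendsto (fun c : ℂ => c • x) (𝓝[≠] 0) (𝓝 0) := by
    have h : Continuous fun c : ℂ => c • x := by fun_prop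
    simpa using (h.tendsto 0).mono_left nhdsWithin_le_nhds
  have h1 : ∀ᶠ c : ℂ in 𝓝[≠] 0, c • x ∈ U := ht hU
  obtain ⟨c, hc, hc0⟩ := (h1.and self_mem_nhdsWithin).exists
  exact ⟨c, hc0, hc⟩

/-- A bilinear map between topological vector spaces that is continuous at the origin is
continuous. -/
theorem continuous_of_bilin {L M E : Type*} [AddCommGroup L] [Module ℂ L] [TopologicalSpace L]
    [AddCommGroup M] [Module ℂ M] [TopologicalSpace M]
    [AddCommGroup E] [Module ℂ E] [TopologicalSpace E]
    [IsTopologicalAddGroup L] [ContinuousSMul ℂ L]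
    [IsTopologicalAddGroup M] [ContinuousSMul ℂ M] [IsTopologicalAddGroup E]
    (f : L →ₗ[ℂ] M →ₗ[ℂ] E)
    (h0 : ∀ W ∈ 𝓝 (0 : E), ∃ U ∈ 𝓝 (0 : L), ∃ V ∈ 𝓝 (0 : M), ∀ x ∈ U, ∀ y ∈ V, f x y ∈ W) :
    Continuous fun p : L × M => f p.1 p.2 := by
  have h00 : Tendsto (fun p : L × M => f p.1 p.2) (𝓝 (0, 0)) (𝓝 0) := by
    intro W hW
    obtain ⟨U, hU, V, hV, h⟩ := h0 W hW
    rw [mem_map]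
    filter_upwards [prod_mem_nhds hU hV] with p hp using h _ hp.1 _ hp.2
  have hl : ∀ m, Tendsto (fun l => f l m) (𝓝 0) (𝓝 0) := by
    intro m W hW
    obtain ⟨U, hU, V, hV, h⟩ := h0 W hW
    obtain ⟨c, hc, hcm⟩ := exists_smul_mem m hV
    have : Tendsto (fun l : L => c⁻¹ • l) (𝓝 0) (𝓝 0) := by
      simpa using (continuous_const_smul c⁻¹ : Continuous fun l : L => c⁻¹ • l).tendsto 0
    rw [mem_map]
    have hU' : ∀ᶠ l : L in 𝓝 0, c⁻¹ • l ∈ U := this hU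
    filter_upwards [hU'] with l hl
    have := h _ hl _ hcm
    simpa [smul_smul, hc] using this
  have hm : ∀ l, Tendsto (fun m => f l m) (𝓝 0) (𝓝 0) := by
    intro l W hW
    obtain ⟨U, hU, V, hV, h⟩ := h0 W hW
    obtain ⟨c, hc, hcl⟩ := exists_smul_mem l hU
    have : Tendsto (fun m : M => c⁻¹ • m) (𝓝 0) (𝓝 0) := by
      simpa using (continuous_const_smul c⁻¹ : Continuous fun m : M => c⁻¹ • m).tendsto 0
    rw [mem_map]
    have hV' : ∀ᶠ m : M in 𝓝 0, c⁻¹ • m ∈ V := this hV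
    filter_upwards [hV'] with m hm
    have := h _ hcl _ hm
    simpa [smul_smul, hc] using this
  rw [continuous_iff_continuousAt]
  rintro ⟨l, m⟩
  have hs1 : Tendsto (fun p : L × M => p.1 - l) (𝓝 (l, m)) (𝓝 0) := by
    have : Continuous fun p : L × M => p.1 - l := by fun_prop
    simpa using this.tendsto (l, m)
  have hs2 : Tendsto (fun p : L × M => p.2 - m) (𝓝 (l, m)) (𝓝 0) := by
    have : Continuous fun p : L × M => p.2 - m := by fun_prop
    simpa using this.tendsto (l, m)
  have hsum := ((h00.comp (hs1.prodMk_nhds hs2)).add ((hl m).comp hs1)).add ((hm l).comp hs2)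
  have := hsum.add_const (f l m)
  simp only [Function.comp_def, map_sub, LinearMap.sub_apply, add_zero, zero_add] at this
  refine this.congr fun p => ?_
  abel

/-- The real convex hull of a (complex) balanced set is balanced. -/
theorem balanced_convexHull {E : Type*} [AddCommGroup E] [Module ℂ E] {T : Set E}
    (hT : Balanced ℂ T) : Balanced ℂ (convexHull ℝ T) := by
  intro a ha
  rintro _ ⟨t, ht, rfl⟩
  have h : convexHull ℝ T ⊆ ((LinearMap.lsmul ℂ E a).restrictScalars ℝ) ⁻¹' convexHull ℝ T :=
    convexHull_min (fun x hx => subset_convexHull ℝ T (hT a ha ⟨x, hx, rfl⟩))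
      ((convex_convexHull ℝ T).linear_preimage _)
  exact h ht

/-- In a locally convex space, the closed absolutely convex neighbourhoods of `0` form a basis. -/
theorem exists_disc {E : Type*} [AddCommGroup E] [Module ℂ E] [TopologicalSpace E]
    [IsTopologicalAddGroup E] [ContinuousSMul ℂ E] [LocallyConvexSpace ℝ E]
    {O : Set E} (hO : O ∈ 𝓝 (0 : E)) :
    ∃ W ∈ 𝓝 (0 : E), IsClosed W ∧ Convex ℝ W ∧ Balanced ℂ W ∧ W ⊆ O := by
  have : ContinuousSMul ℝ E := IsScalarTower.continuousSMul ℂ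
  obtain ⟨O', ⟨hO', hcl⟩, hsub⟩ := (closed_nhds_basis (0 : E)).mem_iff.1 hO
  obtain ⟨C, ⟨hC, hconv⟩, hCO⟩ := (LocallyConvexSpace.convex_basis_zero ℝ E).mem_iff.1 hO'
  have hb : balancedCore ℂ C ∈ 𝓝 (0 : E) := balancedCore_mem_nhds_zero hC
  refine ⟨closure (convexHull ℝ (balancedCore ℂ C)),
    mem_of_superset hb ((subset_convexHull ℝ _).trans subset_closure), isClosed_closure,
    (convex_convexHull ℝ _).closure, (balanced_convexHull (balancedCore_balanced C)).closure, ?_⟩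
  refine (closure_minimal ?_ hcl).trans hsub
  exact (convexHull_min (balancedCore_subset C) hconv).trans hCO

section Nhds

variable {M N : Type*} [AddCommGroup M] [Module ℂ M] [TopologicalSpace M]
  [AddCommGroup N] [Module ℂ N] [TopologicalSpace N]

/-- The image of `U × V` under the canonical bilinear map. -/
def ATensor.prodSet (U : Set M) (V : Set N) : Set (ATensor M N) :=
  (fun p : M × N => ATensor.mk M N p.1 p.2) '' (U ×ˢ V)

theorem ATensor.hull_mem_nhds [ContinuousSMul ℂ M] [ContinuousSMul ℂ N]
    [IsTopologicalAddGroup M] [IsTopologicalAddGroup N]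
    {U : Set M} {V : Set N} (hU : U ∈ 𝓝 (0 : M))
    (hV : V ∈ 𝓝 (0 : N)) : convexHull ℝ (ATensor.prodSet U V) ∈ 𝓝 (0 : ATensor M N) := by
  wlog hUV : Balanced ℂ U ∧ Balanced ℂ V generalizing U V
  · refine mem_of_superset (this (U := balancedCore ℂ U) (V := balancedCore ℂ V)
      (balancedCore_mem_nhds_zero hU) (balancedCore_mem_nhds_zero hV)
      ⟨balancedCore_balanced U, balancedCore_balanced V⟩) (convexHull_mono (image_mono ?_))
    exact prod_mono (balancedCore_subset U) (balancedCore_subset V)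
  obtain ⟨hUb, hVb⟩ := hUV
  set K := convexHull ℝ (ATensor.prodSet U V) with hK
  have hKc : Convex ℝ K := convex_convexHull ℝ _
  have hKb : Balanced ℂ K := by
    refine balanced_convexHull ?_
    intro a ha
    rintro _ ⟨_, ⟨⟨x, y⟩, ⟨hx, hy⟩, rfl⟩, rfl⟩
    exact ⟨(a • x, y), ⟨hUb a ha ⟨x, hx, rfl⟩, hy⟩, by simp⟩
  have h0 : (0 : ATensor M N) ∈ K :=
    subset_convexHull ℝ _ ⟨(0, 0), ⟨mem_of_mem_nhds hU, mem_of_mem_nhds hV⟩, by simp⟩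
  have habs : ∀ t : ATensor M N, ∃ r : ℝ, 0 < r ∧ r • t ∈ K := by
    intro t
    induction t using ATensor.induction with
    | h0 => exact ⟨1, one_pos, by simpa using h0⟩
    | h1 x y =>
      have hx : ∀ᶠ r : ℝ in 𝓝[>] 0, r • x ∈ U := by
        have : Tendsto (fun r : ℝ => r • x) (𝓝[>] 0) (𝓝 0) := by
          have h : Continuous fun r : ℝ => r • x := by
            have : (fun r : ℝ => r • x) = fun r : ℝ => (r : ℂ) • x := by
              ext r; simp
            rw [this]; fun_prop
          simpa using (h.tendsto 0).mono_left nhdsWithin_le_nhds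
        exact this hU
      have hy : ∀ᶠ r : ℝ in 𝓝[>] 0, r • y ∈ V := by
        have : Tendsto (fun r : ℝ => r • y) (𝓝[>] 0) (𝓝 0) := by
          have h : Continuous fun r : ℝ => r • y := by
            have : (fun r : ℝ => r • y) = fun r : ℝ => (r : ℂ) • y := by
              ext r; simp
            rw [this]; fun_prop
          simpa using (h.tendsto 0).mono_left nhdsWithin_le_nhds
        exact this hV
      obtain ⟨r, ⟨hrx, hry⟩, hr⟩ := ((hx.and hy).and self_mem_nhdsWithin).exists
      refine ⟨r * r, mul_pos hr hr, subset_convexHull ℝ _ ⟨(r • x, r • y), ⟨hrx, hry⟩, ?_⟩⟩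
      have e1 : r • x = (r : ℂ) • x := by simp
      have e2 : r • y = (r : ℂ) • y := by simp
      have e3 : (r * r) • ATensor.mk M N x y = ((r * r : ℝ) : ℂ) • ATensor.mk M N x y :=
        (Complex.coe_smul _ _).symm
      simp only [e1, e2, e3, map_smul, LinearMap.smul_apply, smul_smul]
      simp
    | h2 s t hs ht =>
      obtain ⟨a, ha, hs⟩ := hs
      obtain ⟨b, hb, ht⟩ := ht
      refine ⟨a * b / (a + b), by positivity, ?_⟩
      have := hKc hs ht (a := b / (a + b)) (b := a / (a + b)) (by positivity) (by positivity)
        (by field_simp; ring)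
      convert this using 1
      simp only [smul_add, smul_smul]
      congr 2 <;> ring
  have hAbs : Absorbent ℝ K := by
    intro t
    obtain ⟨r, hr, hrt⟩ := habs t
    rw [absorbs_iff_norm]
    refine ⟨r⁻¹, fun c hc => ?_⟩
    rw [singleton_subset_iff]
    have hcpos : 0 < ‖c‖ := (inv_pos.2 hr).trans_le hc
    have hc0 : c ≠ 0 := norm_pos_iff.1 hcpos
    rw [mem_smul_set_iff_inv_smul_mem₀ hc0]
    have h1 : c⁻¹ • t = ((c⁻¹ * r⁻¹ : ℝ) : ℂ) • (r • t) := by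
      have : c⁻¹ • t = (c⁻¹ * r⁻¹) • (r • t) := by
        rw [smul_smul]; congr 1; field_simp
      rw [this]; exact (Complex.coe_smul _ _).symm
    rw [h1]
    refine hKb _ ?_ ⟨_, hrt, rfl⟩
    rw [Complex.norm_real, norm_mul, norm_inv, norm_inv, Real.norm_of_nonneg hr.le]
    rw [← mul_inv]
    apply inv_le_one_of_one_le₀
    rwa [inv_le_iff_one_le_mul₀ hr] at hc
  let p : Seminorm ℂ (ATensor M N) := gaugeSeminorm hKb hKc hAbs
  let t : TopologicalSpace (ATensor M N) :=
    p.toSeminormedAddCommGroup.toUniformSpace.toTopologicalSpace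
  have ht : t ∈ ATensor.admissibleTopologies M N := by
    let _ : SeminormedAddCommGroup (ATensor M N) := p.toSeminormedAddCommGroup
    let _ : NormedSpace ℂ (ATensor M N) :=
      { norm_smul_le := fun a b => le_of_eq (map_smul_eq_mul p a b) }
    refine ⟨inferInstance, inferInstance, ?_, ?_⟩
    · exact NormedSpace.toLocallyConvexSpace' ℂ
    · refine continuous_of_bilin (ATensor.mk M N) fun W hW => ?_
      obtain ⟨ε, hε, hW⟩ := Metric.mem_nhds_iff.1 hW
      have hε2 : ((ε / 2 : ℝ) : ℂ) ≠ 0 := by exact Complex.ofReal_ne_zero.2 (half_pos hε).ne'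
      refine ⟨U, hU, ((ε / 2 : ℝ) : ℂ) • V, (set_smul_mem_nhds_zero_iff hε2).2 hV, ?_⟩
      rintro x hx _ ⟨y, hy, rfl⟩
      apply hW
      have h1 : p (ATensor.mk M N x y) ≤ 1 :=
        gauge_le_one_of_mem (subset_convexHull ℝ _ ⟨(x, y), ⟨hx, hy⟩, rfl⟩)
      have h2 : p (ATensor.mk M N x (((ε / 2 : ℝ) : ℂ) • y)) < ε := by
        rw [map_smul, map_smul_eq_mul, Complex.norm_real, Real.norm_of_nonneg (half_pos hε).le]
        nlinarith
      rw [mem_ball_zero_iff]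
      exact h2
  have hle : sInf (ATensor.admissibleTopologies M N) ≤ t := sInf_le ht
  have hKt : K ∈ @nhds _ t 0 := by
    let _ : SeminormedAddCommGroup (ATensor M N) := p.toSeminormedAddCommGroup
    refine Metric.mem_nhds_iff.2 ⟨1, one_pos, fun x hx => ?_⟩
    rw [mem_ball_zero_iff] at hx
    exact setOfPred_gauge_lt_one_subset_self hKc h0 hAbs hx
  exact _root_.nhds_mono hle hKt

end Nhds
section Hereditary

variable {E : Type*} [AddCommGroup E] [Module ℂ E]

theorem FrechetSpace.of_uniform [UniformSpace E] [IsUniformAddGroup E] [ContinuousSMul ℂ E]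
    [LocallyConvexSpace ℝ E] [T0Space E] [(uniformity E).IsCountablyGenerated] [CompleteSpace E] :
    FrechetSpace E where
  metrizable := UniformSpace.metrizableSpace
  complete := by rw [IsUniformAddGroup.rightUniformSpace_eq]; infer_instance

variable [TopologicalSpace E]

instance FrechetSpace.submodule [FrechetSpace E] (S : Submodule ℂ E)
    [hS : IsClosed (S : Set E)] : FrechetSpace S := by
  let _ : UniformSpace E := IsTopologicalAddGroup.rightUniformSpace E
  have : IsUniformAddGroup E := isUniformAddGroup_of_addCommGroup
  have hc : CompleteSpace E := FrechetSpace.complete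
  have : CompleteSpace S := hS.completeSpace_coe
  have : IsUniformAddGroup S := inferInstanceAs (IsUniformAddGroup S.toAddSubgroup)
  have : (uniformity E).IsCountablyGenerated :=
    IsUniformAddGroup.uniformity_countably_generated
  have : (uniformity S).IsCountablyGenerated :=
    inferInstanceAs (uniformity (S : Set E)).IsCountablyGenerated
  have : LocallyConvexSpace ℝ S :=
    inferInstanceAs (LocallyConvexSpace ℝ (S.restrictScalars ℝ))
  exact FrechetSpace.of_uniform

instance FrechetSpace.quotient [FrechetSpace E] (S : Submodule ℂ E)
    [hS : IsClosed (S : Set E)] : FrechetSpace (E ⧸ S) := by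
  have hc : @CompleteSpace E (IsTopologicalAddGroup.rightUniformSpace E) := FrechetSpace.complete
  have hq : @CompleteSpace (E ⧸ S) (IsTopologicalAddGroup.rightUniformSpace (E ⧸ S)) :=
    QuotientAddGroup.completeSpace_right' E S.toAddSubgroup
  have hl : LocallyConvexSpace ℝ (E ⧸ S) := by
    rw [locallyConvexSpace_iff_exists_convex_subset_zero]
    intro U hU
    have h1 : S.mkQ ⁻¹' U ∈ 𝓝 (0 : E) := by
      have : Tendsto S.mkQ (𝓝 0) (𝓝 0) := by
        have h : Continuous S.mkQ := continuous_quot_mk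
        have := h.tendsto 0
        rwa [map_zero] at this
      exact this hU
    obtain ⟨C, ⟨hC, hconv⟩, hCU⟩ := (LocallyConvexSpace.convex_basis_zero ℝ E).mem_iff.1 h1
    refine ⟨S.mkQ '' C, ?_, hconv.is_linear_image ⟨?_, ?_⟩, image_subset_iff.2 hCU⟩
    · have := S.isOpenMap_mkQ.image_mem_nhds hC
      simpa using this
    · exact map_add _
    · intro c x; rfl
  have : FirstCountableTopology (E ⧸ S) :=
    inferInstanceAs (FirstCountableTopology (E ⧸ S.toAddSubgroup))
  let _ : UniformSpace (E ⧸ S) := IsTopologicalAddGroup.rightUniformSpace (E ⧸ S)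
  have : IsUniformAddGroup (E ⧸ S) := isUniformAddGroup_of_addCommGroup
  have : (uniformity (E ⧸ S)).IsCountablyGenerated :=
    IsUniformAddGroup.uniformity_countably_generated
  exact FrechetSpace.of_uniform

end Hereditary

section Completion

open UniformSpace

variable (M N : Type*) [AddCommGroup M] [Module ℂ M] [TopologicalSpace M]
  [AddCommGroup N] [Module ℂ N] [TopologicalSpace N]

instance : UniformContinuousConstSMul ℂ (ATensor M N) :=
  uniformContinuousConstSMul_of_continuousConstSMul _ _

/-- The completed projective tensor product `M ⊗̂ N`: the completion of `M ⊗ N` with respect to the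
projective topology. -/
def CTensor : Type _ := Completion (ATensor M N)

instance : AddCommGroup (CTensor M N) := inferInstanceAs (AddCommGroup (Completion (ATensor M N)))
instance : Module ℂ (CTensor M N) := inferInstanceAs (Module ℂ (Completion (ATensor M N)))
instance : UniformSpace (CTensor M N) := inferInstanceAs (UniformSpace (Completion (ATensor M N)))
instance : IsUniformAddGroup (CTensor M N) :=
  inferInstanceAs (IsUniformAddGroup (Completion (ATensor M N)))
instance : CompleteSpace (CTensor M N) := inferInstanceAs (CompleteSpace (Completion (ATensor M N)))
instance : T2Space (CTensor M N) := inferInstanceAs (T2Space (Completion (ATensor M N)))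

/-- The canonical map from `M ⊗ N` to its completion. -/
def CTensor.ι : ATensor M N →ₗ[ℂ] CTensor M N where
  toFun t := (t : Completion (ATensor M N))
  map_add' := Completion.coe_add
  map_smul' c t := Completion.coe_smul c t

theorem CTensor.isDenseInducing_ι : IsDenseInducing (CTensor.ι M N) :=
  Completion.isDenseInducing_coe

/-- The canonical bilinear map `(x, y) ↦ x ⊗ y` from `M × N` to `M ⊗̂ N`. -/
def CTensor.mk : M →ₗ[ℂ] N →ₗ[ℂ] CTensor M N := (ATensor.mk M N).compr₂ (CTensor.ι M N)

theorem CTensor.continuous_mk : Continuous (fun p : M × N => CTensor.mk M N p.1 p.2) :=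
  (CTensor.isDenseInducing_ι M N).continuous.comp (ATensor.continuous_mk M N)

variable {M N}

theorem CTensor.closure_nhds {V : Set (ATensor M N)} (hV : V ∈ 𝓝 0) :
    closure (CTensor.ι M N '' V) ∈ 𝓝 (0 : CTensor M N) := by
  simpa using (CTensor.isDenseInducing_ι M N).closure_image_mem_nhds hV

theorem CTensor.preimage_nhds {V : Set (CTensor M N)} (hV : V ∈ 𝓝 0) :
    CTensor.ι M N ⁻¹' V ∈ 𝓝 (0 : ATensor M N) := by
  have := (CTensor.isDenseInducing_ι M N).continuous.tendsto 0
  rw [map_zero] at this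
  exact this hV

instance : ContinuousSMul ℂ (CTensor M N) := by
  have hcs : ∀ c : ℂ, Continuous fun t : CTensor M N => c • t := fun c =>
    (uniformContinuous_const_smul (M := ℂ) (X := Completion (ATensor M N)) c).continuous
  have key : ∀ W ∈ 𝓝 (0 : CTensor M N), ∃ r > 0, ∃ V ∈ 𝓝 (0 : CTensor M N),
      ∀ c : ℂ, ‖c‖ < r → ∀ t ∈ V, c • t ∈ W := by
    intro W hW
    obtain ⟨W', ⟨hW', hcl⟩, hsub⟩ := (closed_nhds_basis (0 : CTensor M N)).mem_iff.1 hW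
    have h1 : Tendsto (fun p : ℂ × ATensor M N => p.1 • p.2) (𝓝 (0, 0)) (𝓝 0) := by
      have : Continuous (fun p : ℂ × ATensor M N => p.1 • p.2) := continuous_smul
      simpa using this.tendsto (0, 0)
    have h2 := tendsto_def.1 h1 _ (CTensor.preimage_nhds hW')
    rw [nhds_prod_eq, mem_prod_iff] at h2
    obtain ⟨B, hB, V, hV, hBV⟩ := h2
    obtain ⟨r, hr, hrB⟩ := Metric.mem_nhds_iff.1 hB
    refine ⟨r, hr, closure (CTensor.ι M N '' V), CTensor.closure_nhds hV, fun c hc t ht => hsub ?_⟩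
    have : closure (CTensor.ι M N '' V) ⊆ (fun t => c • t) ⁻¹' W' := by
      refine closure_minimal ?_ (hcl.preimage (hcs c))
      rintro _ ⟨v, hv, rfl⟩
      have hcB : c ∈ B := hrB (mem_ball_zero_iff.2 hc)
      have h3 := hBV (mk_mem_prod hcB hv)
      simp only [mem_preimage, map_smul] at h3 ⊢
      exact h3
    exact this ht
  refine ContinuousSMul.of_nhds_zero ?_ ?_ ?_
  · intro W hW
    obtain ⟨r, hr, V, hV, h⟩ := key W hW
    rw [mem_map]
    filter_upwards [prod_mem_prod (Metric.ball_mem_nhds (0 : ℂ) hr) hV] with p hp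
    exact h _ (by simpa using hp.1) _ hp.2
  · intro t W hW
    obtain ⟨W', hW', hadd⟩ := exists_nhds_zero_half hW
    obtain ⟨r, hr, V, hV, h⟩ := key W' hW'
    obtain ⟨s, hs⟩ : ∃ s, t - CTensor.ι M N s ∈ V := by
      have h1 : {u | t - u ∈ V} ∈ 𝓝 t := by
        have : Continuous fun u : CTensor M N => t - u := by fun_prop
        have := this.tendsto t
        rw [sub_self] at this
        exact this hV
      obtain ⟨_, ⟨s, rfl⟩, hu⟩ := (CTensor.isDenseInducing_ι M N).dense.inter_nhds_nonempty h1
      exact ⟨s, hu⟩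
    have h2 : Tendsto (fun c : ℂ => CTensor.ι M N (c • s)) (𝓝 0) (𝓝 0) := by
      have : Continuous fun c : ℂ => CTensor.ι M N (c • s) :=
        (CTensor.isDenseInducing_ι M N).continuous.comp (by fun_prop)
      simpa using this.tendsto 0
    rw [mem_map]
    have h3 : ∀ᶠ c : ℂ in 𝓝 0, CTensor.ι M N (c • s) ∈ W' := h2 hW'
    filter_upwards [h3, Metric.ball_mem_nhds (0 : ℂ) hr] with c hc hcr
    have := hadd _ (h c (by simpa using hcr) _ hs) _ hc
    simpa [smul_sub] using this
  · intro c
    simpa using (hcs c).tendsto 0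

instance : LocallyConvexSpace ℝ (CTensor M N) := by
  have hR : ContinuousSMul ℝ (CTensor M N) := IsScalarTower.continuousSMul ℂ
  have hR' : ContinuousSMul ℝ (ATensor M N) := IsScalarTower.continuousSMul ℂ
  rw [locallyConvexSpace_iff_exists_convex_subset_zero]
  intro U hU
  obtain ⟨W, ⟨hW, hcl⟩, hsub⟩ := (closed_nhds_basis (0 : CTensor M N)).mem_iff.1 hU
  obtain ⟨C, ⟨hC, hconv⟩, hCU⟩ :=
    (LocallyConvexSpace.convex_basis_zero ℝ (ATensor M N)).mem_iff.1 (CTensor.preimage_nhds hW)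
  refine ⟨_, CTensor.closure_nhds hC, Convex.closure ?_,
    (closure_minimal (image_subset_iff.2 hCU) hcl).trans hsub⟩
  exact hconv.linear_image ((CTensor.ι M N).restrictScalars ℝ)

instance [FrechetSpace M] [FrechetSpace N] : FrechetSpace (CTensor M N) := by
  have h0 : (𝓝 (0 : ATensor M N)).IsCountablyGenerated := by
    obtain ⟨U, hU⟩ := (𝓝 (0 : M)).exists_antitone_basis
    obtain ⟨V, hV⟩ := (𝓝 (0 : N)).exists_antitone_basis
    have hb : (𝓝 (0 : ATensor M N)).HasBasis (fun _ : ℕ => True)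
        (fun n => convexHull ℝ (ATensor.prodSet (U n) (V n))) := by
      refine ⟨fun W => ⟨fun hW => ?_, ?_⟩⟩
      · obtain ⟨C, ⟨hC, hconv⟩, hCW⟩ :=
          (LocallyConvexSpace.convex_basis_zero ℝ (ATensor M N)).mem_iff.1 hW
        have h1 : Tendsto (fun p : M × N => ATensor.mk M N p.1 p.2) (𝓝 (0, 0)) (𝓝 0) := by
          simpa using (ATensor.continuous_mk M N).tendsto (0, 0)
        have h2 := h1 hC
        rw [mem_map, nhds_prod_eq] at h2
        obtain ⟨n, hn⟩ := (hU.prod hV).mem_iff.1 h2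
        exact ⟨n, trivial, (convexHull_min (image_subset_iff.2 hn) hconv).trans hCW⟩
      · rintro ⟨n, -, hn⟩
        exact mem_of_superset (ATensor.hull_mem_nhds (hU.mem n) (hV.mem n)) hn
    exact hb.isCountablyGenerated
  have h1 : (𝓝 (0 : CTensor M N)).IsCountablyGenerated := by
    obtain ⟨U, hU⟩ := (𝓝 (0 : ATensor M N)).exists_antitone_basis
    have := (hU.toHasBasis.hasBasis_of_isDenseInducing (CTensor.isDenseInducing_ι M N))
    rw [map_zero] at this
    exact this.isCountablyGenerated
  have h2 : (uniformity (CTensor M N)).IsCountablyGenerated :=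
    IsUniformAddGroup.uniformity_countably_generated
  exact FrechetSpace.of_uniform

end Completion
section Lift

open UniformSpace

variable {M N M' N' M'' N'' E : Type*}
  [AddCommGroup M] [Module ℂ M] [TopologicalSpace M]
  [AddCommGroup N] [Module ℂ N] [TopologicalSpace N]
  [AddCommGroup M'] [Module ℂ M'] [TopologicalSpace M']
  [AddCommGroup N'] [Module ℂ N'] [TopologicalSpace N']
  [AddCommGroup M''] [Module ℂ M''] [TopologicalSpace M'']
  [AddCommGroup N''] [Module ℂ N''] [TopologicalSpace N'']
  [AddCommGroup E] [Module ℂ E] [TopologicalSpace E]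

set_option linter.unusedSectionVars false in
/-- Two continuous additive maps on `M ⊗̂ N` agreeing on elementary tensors are equal. -/
theorem CTensor.eq_of_mk [T2Space E] {f g : CTensor M N → E} (hf : Continuous f) (hg : Continuous g)
    (hfa : ∀ s t, f (s + t) = f s + f t) (hga : ∀ s t, g (s + t) = g s + g t)
    (h : ∀ x y, f (CTensor.mk M N x y) = g (CTensor.mk M N x y)) (t : CTensor M N) :
    f t = g t := by
  refine congrFun ((CTensor.isDenseInducing_ι M N).dense.equalizer hf hg (funext fun s => ?_)) t
  induction s using ATensor.induction with
  | h0 => simpa using h 0 0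
  | h1 x y => exact h x y
  | h2 s t hs ht => simp only [Function.comp_apply, map_add, hfa, hga] at hs ht ⊢; rw [hs, ht]

theorem CTensor.ext [T2Space E] {f g : CTensor M N →L[ℂ] E}
    (h : ∀ x y, f (CTensor.mk M N x y) = g (CTensor.mk M N x y)) : f = g :=
  ContinuousLinearMap.ext fun t =>
    CTensor.eq_of_mk f.continuous g.continuous (map_add f) (map_add g) h t

/-- The extension of a continuous linear map on `M ⊗ N` to `M ⊗̂ N`. -/
def CTensor.extend [FrechetSpace E] (f : ATensor M N →L[ℂ] E) : CTensor M N →L[ℂ] E :=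
  letI : UniformSpace E := IsTopologicalAddGroup.rightUniformSpace E
  haveI : IsUniformAddGroup E := isUniformAddGroup_of_addCommGroup
  haveI : CompleteSpace E := FrechetSpace.complete
  haveI : UniformContinuousConstSMul ℂ E := uniformContinuousConstSMul_of_continuousConstSMul _ _
  ContinuousLinearMap.fromCompletion (α := ATensor M N) f

theorem CTensor.extend_ι [FrechetSpace E] (f : ATensor M N →L[ℂ] E) (t : ATensor M N) :
    CTensor.extend f (CTensor.ι M N t) = f t := by
  let _ : UniformSpace E := IsTopologicalAddGroup.rightUniformSpace E
  have : IsUniformAddGroup E := isUniformAddGroup_of_addCommGroup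
  have hE : CompleteSpace E := FrechetSpace.complete
  have : UniformContinuousConstSMul ℂ E := uniformContinuousConstSMul_of_continuousConstSMul _ _
  exact ContinuousLinearMap.fromCompletion_apply_coe f t

/-- The universal property of `M ⊗̂ N`: a jointly continuous bilinear map `M × N → E` to a Fréchet
space induces a continuous linear map `M ⊗̂ N → E`. -/
def CTensor.lift [FrechetSpace E] (f : M →ₗ[ℂ] N →ₗ[ℂ] E)
    (hf : Continuous fun p : M × N => f p.1 p.2) : CTensor M N →L[ℂ] E :=
  CTensor.extend ⟨TensorProduct.lift f, ATensor.continuous_of_mk (TensorProduct.lift f) hf⟩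

@[simp]
theorem CTensor.lift_mk [FrechetSpace E] (f : M →ₗ[ℂ] N →ₗ[ℂ] E)
    (hf : Continuous fun p : M × N => f p.1 p.2) (x : M) (y : N) :
    CTensor.lift f hf (CTensor.mk M N x y) = f x y :=
  (CTensor.extend_ι _ (ATensor.mk M N x y)).trans (TensorProduct.lift.tmul x y)

/-- The map `f ⊗̂ g : M ⊗̂ N → M' ⊗̂ N'`, `x ⊗ y ↦ f x ⊗ g y`. -/
def CTensor.map [FrechetSpace M'] [FrechetSpace N'] (f : M →L[ℂ] M') (g : N →L[ℂ] N') :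
    CTensor M N →L[ℂ] CTensor M' N' :=
  CTensor.lift ((CTensor.mk M' N').compl₁₂ f.toLinearMap g.toLinearMap)
    ((CTensor.continuous_mk M' N').comp (f.continuous.prodMap g.continuous))

@[simp]
theorem CTensor.map_mk [FrechetSpace M'] [FrechetSpace N'] (f : M →L[ℂ] M') (g : N →L[ℂ] N')
    (x : M) (y : N) : CTensor.map f g (CTensor.mk M N x y) = CTensor.mk M' N' (f x) (g y) :=
  CTensor.lift_mk _ _ x y

/-- A bilinear map `L × (M ⊗̂ N) → E` that is continuous in the second variable and whose
associated trilinear map `L × M × N → E` is jointly continuous is itself jointly continuous. -/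
theorem CTensor.continuous_of_trilinear {L : Type*} [AddCommGroup L] [Module ℂ L]
    [TopologicalSpace L] [IsTopologicalAddGroup L] [ContinuousSMul ℂ L]
    [FrechetSpace M] [FrechetSpace N] [FrechetSpace E]
    (F : L →ₗ[ℂ] CTensor M N →ₗ[ℂ] E) (hF : ∀ l, Continuous (F l))
    (h : Continuous fun p : L × M × N => F p.1 (CTensor.mk M N p.2.1 p.2.2)) :
    Continuous fun p : L × CTensor M N => F p.1 p.2 := by
  refine continuous_of_bilin F fun O hO => ?_
  obtain ⟨W, hW, hcl, hconv, -, hWO⟩ := exists_disc hO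
  have h1 : Tendsto (fun p : L × M × N => F p.1 (CTensor.mk M N p.2.1 p.2.2))
      (𝓝 (0, 0, 0)) (𝓝 0) := by
    simpa using h.tendsto (0, 0, 0)
  have h2 := tendsto_def.1 h1 _ hW
  rw [nhds_prod_eq, mem_prod_iff] at h2
  obtain ⟨U, hU, V, hV, hUV⟩ := h2
  rw [nhds_prod_eq, mem_prod_iff] at hV
  obtain ⟨V1, hV1, V2, hV2, hV12⟩ := hV
  refine ⟨U, hU, _, CTensor.closure_nhds (ATensor.hull_mem_nhds hV1 hV2), fun l hl t ht => hWO ?_⟩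
  have h3 : closure (CTensor.ι M N '' convexHull ℝ (ATensor.prodSet V1 V2)) ⊆ F l ⁻¹' W := by
    refine closure_minimal (image_subset_iff.2 (convexHull_min ?_ ?_)) (hcl.preimage (hF l))
    · rintro _ ⟨⟨x, y⟩, hxy, rfl⟩
      exact hUV (mk_mem_prod hl (hV12 hxy))
    · exact (hconv.linear_preimage ((F l).restrictScalars ℝ)).linear_preimage
        ((CTensor.ι M N).restrictScalars ℝ)
  exact h3 ht

end Lift

section Modules

/-- A Fréchet algebra over `ℂ` (associative and unital). -/
class FrechetAlgebra (A : Type*) [Ring A] [Algebra ℂ A] [TopologicalSpace A] : Prop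
    extends FrechetSpace A, ContinuousMul A

/-- A left Fréchet `A`-module: a Fréchet space with a jointly continuous unital action of `A`,
compatible with the complex scalars. Right Fréchet `A`-modules are left Fréchet `Aᵐᵒᵖ`-modules. -/
class FrechetModule (A M : Type*) [Ring A] [Algebra ℂ A] [TopologicalSpace A]
    [AddCommGroup M] [Module ℂ M] [TopologicalSpace M] [FrechetSpace M] [Module A M] : Prop
    extends IsScalarTower ℂ A M, ContinuousSMul A M

variable {A : Type*} [Ring A] [Algebra ℂ A] [TopologicalSpace A]
variable {M : Type*} [AddCommGroup M] [Module ℂ M] [TopologicalSpace M] [FrechetSpace M]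
variable {N : Type*} [AddCommGroup N] [Module ℂ N] [TopologicalSpace N] [FrechetSpace N]

/-- The action of an element `a` on a Fréchet module, as a continuous linear map. -/
def act [Module A M] [FrechetModule A M] (a : A) : M →L[ℂ] M where
  toFun x := a • x
  map_add' := smul_add a
  map_smul' c x := smul_algebra_smul_comm c a x
  cont := continuous_const_smul a

@[simp]
theorem act_apply [Module A M] [FrechetModule A M] (a : A) (x : M) : act a x = a • x := rfl

instance FrechetAlgebra.left [FrechetAlgebra A] : FrechetModule A A where

instance FrechetAlgebra.right [FrechetAlgebra A] : FrechetModule Aᵐᵒᵖ A where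

instance [IsTopologicalAddGroup A] : IsTopologicalAddGroup Aᵐᵒᵖ where

/-- The action on the first tensor factor, `(a, x ⊗ y) ↦ a x ⊗ y`. -/
def CTensor.actFst (A M N : Type*) [Ring A] [Algebra ℂ A] [TopologicalSpace A]
    [AddCommGroup M] [Module ℂ M] [TopologicalSpace M] [FrechetSpace M]
    [AddCommGroup N] [Module ℂ N] [TopologicalSpace N] [FrechetSpace N]
    [Module A M] [FrechetModule A M] : A →ₗ[ℂ] CTensor M N →ₗ[ℂ] CTensor M N where
  toFun a := (CTensor.map (act a) (ContinuousLinearMap.id ℂ N)).toLinearMap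
  map_add' a b := by
    rw [← ContinuousLinearMap.toLinearMap_add]
    congr 1
    exact CTensor.ext fun x y => by simp [add_smul]
  map_smul' c a := by
    rw [RingHom.id_apply, ← ContinuousLinearMap.toLinearMap_smul]
    congr 1
    exact CTensor.ext fun x y => by simp [smul_assoc]

/-- The action on the second tensor factor, `(a, x ⊗ y) ↦ x ⊗ a y`. -/
def CTensor.actSnd (A M N : Type*) [Ring A] [Algebra ℂ A] [TopologicalSpace A]
    [AddCommGroup M] [Module ℂ M] [TopologicalSpace M] [FrechetSpace M]
    [AddCommGroup N] [Module ℂ N] [TopologicalSpace N] [FrechetSpace N]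
    [Module A N] [FrechetModule A N] : A →ₗ[ℂ] CTensor M N →ₗ[ℂ] CTensor M N where
  toFun a := (CTensor.map (ContinuousLinearMap.id ℂ M) (act a)).toLinearMap
  map_add' a b := by
    rw [← ContinuousLinearMap.toLinearMap_add]
    congr 1
    exact CTensor.ext fun x y => by simp [add_smul]
  map_smul' c a := by
    rw [RingHom.id_apply, ← ContinuousLinearMap.toLinearMap_smul]
    congr 1
    exact CTensor.ext fun x y => by simp [smul_assoc]

section

variable [Module A M] [FrechetModule A M]

@[simp]
theorem CTensor.actFst_mk (a : A) (x : M) (y : N) :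
    CTensor.actFst A M N a (CTensor.mk M N x y) = CTensor.mk M N (a • x) y :=
  CTensor.map_mk _ _ x y

theorem CTensor.continuous_actFst_right (a : A) : Continuous (CTensor.actFst A M N a) :=
  (CTensor.map (act a) (ContinuousLinearMap.id ℂ N)).continuous

theorem CTensor.continuous_actFst [IsTopologicalAddGroup A] [ContinuousSMul ℂ A] :
    Continuous fun p : A × CTensor M N => CTensor.actFst A M N p.1 p.2 := by
  refine CTensor.continuous_of_trilinear _ (fun a => CTensor.continuous_actFst_right a) ?_
  simp only [CTensor.actFst_mk]
  exact (CTensor.continuous_mk M N).comp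
    (f := fun p : A × M × N => (p.1 • p.2.1, p.2.2)) (by fun_prop)

end

section

variable [Module A N] [FrechetModule A N]

@[simp]
theorem CTensor.actSnd_mk (a : A) (x : M) (y : N) :
    CTensor.actSnd A M N a (CTensor.mk M N x y) = CTensor.mk M N x (a • y) :=
  CTensor.map_mk _ _ x y

theorem CTensor.continuous_actSnd_right (a : A) : Continuous (CTensor.actSnd A M N a) :=
  (CTensor.map (ContinuousLinearMap.id ℂ M) (act a)).continuous

theorem CTensor.continuous_actSnd [IsTopologicalAddGroup A] [ContinuousSMul ℂ A] :
    Continuous fun p : A × CTensor M N => CTensor.actSnd A M N p.1 p.2 := by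
  refine CTensor.continuous_of_trilinear _ (fun a => CTensor.continuous_actSnd_right a) ?_
  simp only [CTensor.actSnd_mk]
  exact (CTensor.continuous_mk M N).comp
    (f := fun p : A × M × N => (p.2.1, p.1 • p.2.2)) (by fun_prop)

end

end Modules
section ModuleTensor

open MulOpposite

variable (A : Type*) [Ring A]
variable (M : Type*) [AddCommGroup M] [Module ℂ M] [TopologicalSpace M] [FrechetSpace M]
  [Module Aᵐᵒᵖ M]
variable (N : Type*) [AddCommGroup N] [Module ℂ N] [TopologicalSpace N] [FrechetSpace N]
  [Module A N]

/-- The closed linear span in `M ⊗̂ N` of all elements `x·a ⊗ y - x ⊗ a·y`. -/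
def balancedSubmodule : Submodule ℂ (CTensor M N) :=
  (Submodule.span ℂ {t | ∃ (x : M) (a : A) (y : N),
    t = CTensor.mk M N (op a • x) y - CTensor.mk M N x (a • y)}).topologicalClosure

instance : IsClosed (balancedSubmodule A M N : Set (CTensor M N)) :=
  Submodule.isClosed_topologicalClosure _

/-- The `A`-module tensor product `M ⊗̂_A N` of a right Fréchet module `M` and a left Fréchet
module `N`. -/
def ModTensor : Type _ := CTensor M N ⧸ balancedSubmodule A M N

instance : AddCommGroup (ModTensor A M N) :=
  inferInstanceAs (AddCommGroup (CTensor M N ⧸ balancedSubmodule A M N))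
instance : Module ℂ (ModTensor A M N) :=
  inferInstanceAs (Module ℂ (CTensor M N ⧸ balancedSubmodule A M N))
instance : TopologicalSpace (ModTensor A M N) :=
  inferInstanceAs (TopologicalSpace (CTensor M N ⧸ balancedSubmodule A M N))
instance : FrechetSpace (ModTensor A M N) :=
  inferInstanceAs (FrechetSpace (CTensor M N ⧸ balancedSubmodule A M N))

/-- The quotient map `M ⊗̂ N → M ⊗̂_A N`. -/
def ModTensor.π : CTensor M N →L[ℂ] ModTensor A M N :=
  ⟨(balancedSubmodule A M N).mkQ, continuous_quot_mk⟩

theorem ModTensor.π_surjective : Function.Surjective (ModTensor.π A M N) :=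
  Submodule.mkQ_surjective _

/-- The canonical balanced bilinear map `(x, y) ↦ x ⊗_A y`. -/
def ModTensor.mk : M →ₗ[ℂ] N →ₗ[ℂ] ModTensor A M N :=
  (CTensor.mk M N).compr₂ (ModTensor.π A M N).toLinearMap

theorem ModTensor.continuous_mk :
    Continuous (fun p : M × N => ModTensor.mk A M N p.1 p.2) :=
  (ModTensor.π A M N).continuous.comp (CTensor.continuous_mk M N)

variable {A M N}

theorem ModTensor.mk_smul (x : M) (a : A) (y : N) :
    ModTensor.mk A M N (op a • x) y = ModTensor.mk A M N x (a • y) := by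
  refine (Submodule.Quotient.eq _).2 (Submodule.le_topologicalClosure _ (Submodule.subset_span ?_))
  exact ⟨x, a, y, rfl⟩

variable {E : Type*} [AddCommGroup E] [Module ℂ E] [TopologicalSpace E]

theorem ModTensor.ext [T2Space E] {f g : ModTensor A M N →L[ℂ] E}
    (h : ∀ x y, f (ModTensor.mk A M N x y) = g (ModTensor.mk A M N x y)) : f = g := by
  have h1 : f.comp (ModTensor.π A M N) = g.comp (ModTensor.π A M N) := CTensor.ext h
  ext t
  obtain ⟨t, rfl⟩ := ModTensor.π_surjective A M N t
  exact congrArg (fun k => k t) h1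

/-- The universal property of `M ⊗̂_A N`: a jointly continuous `A`-balanced bilinear map
`M × N → E` to a Fréchet space induces a continuous linear map `M ⊗̂_A N → E`. -/
def ModTensor.lift [FrechetSpace E] (f : M →ₗ[ℂ] N →ₗ[ℂ] E)
    (hf : Continuous fun p : M × N => f p.1 p.2)
    (hbal : ∀ x (a : A) y, f (op a • x) y = f x (a • y)) : ModTensor A M N →L[ℂ] E :=
  ⟨(balancedSubmodule A M N).liftQ (CTensor.lift f hf).toLinearMap (by
    refine Submodule.topologicalClosure_minimal _ (Submodule.span_le.2 ?_)
      (isClosed_singleton.preimage (CTensor.lift f hf).continuous)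
    rintro _ ⟨x, a, y, rfl⟩
    simp [hbal]), continuous_quot_lift _ (CTensor.lift f hf).continuous⟩

@[simp]
theorem ModTensor.lift_mk [FrechetSpace E] (f : M →ₗ[ℂ] N →ₗ[ℂ] E)
    (hf : Continuous fun p : M × N => f p.1 p.2)
    (hbal : ∀ x (a : A) y, f (op a • x) y = f x (a • y)) (x : M) (y : N) :
    ModTensor.lift f hf hbal (ModTensor.mk A M N x y) = f x y :=
  CTensor.lift_mk f hf x y

variable {M' : Type*} [AddCommGroup M'] [Module ℂ M'] [TopologicalSpace M'] [FrechetSpace M']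
  [Module Aᵐᵒᵖ M']
variable {N' : Type*} [AddCommGroup N'] [Module ℂ N'] [TopologicalSpace N'] [FrechetSpace N']
  [Module A N']

/-- The map `f ⊗̂_A g : M ⊗̂_A N → M' ⊗̂_A N'` induced by module morphisms `f` and `g`. -/
def ModTensor.map (f : M →L[ℂ] M') (hf : ∀ (a : A) x, f (op a • x) = op a • f x)
    (g : N →L[ℂ] N') (hg : ∀ (a : A) y, g (a • y) = a • g y) :
    ModTensor A M N →L[ℂ] ModTensor A M' N' :=
  ModTensor.lift ((ModTensor.mk A M' N').compl₁₂ f.toLinearMap g.toLinearMap)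
    (Continuous.comp (g := fun p : M' × N' => ModTensor.mk A M' N' p.1 p.2)
      (f := fun p : M × N => (f p.1, g p.2)) (ModTensor.continuous_mk A M' N') (by fun_prop))
    (fun x a y => by simp [hf, hg, ModTensor.mk_smul])

@[simp]
theorem ModTensor.map_mk (f : M →L[ℂ] M') (hf : ∀ (a : A) x, f (op a • x) = op a • f x)
    (g : N →L[ℂ] N') (hg : ∀ (a : A) y, g (a • y) = a • g y) (x : M) (y : N) :
    ModTensor.map f hf g hg (ModTensor.mk A M N x y) = ModTensor.mk A M' N' (f x) (g y) :=
  ModTensor.lift_mk _ _ _ x y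

/-- If `N` is moreover a right `R`-module with commuting actions, then `R` acts from the right on
`M ⊗̂_A N` by `(x ⊗ y)·r = x ⊗ y·r`. -/
instance {R : Type*} [Ring R] [Algebra ℂ R] [TopologicalSpace R] [Module Rᵐᵒᵖ N]
    [FrechetModule Rᵐᵒᵖ N] [SMulCommClass A Rᵐᵒᵖ N] : SMul Rᵐᵒᵖ (ModTensor A M N) where
  smul r := ModTensor.map (ContinuousLinearMap.id ℂ M) (fun _ _ => rfl) (act r)
    (fun a y => (smul_comm a r y).symm)

theorem ModTensor.smul_def {R : Type*} [Ring R] [Algebra ℂ R] [TopologicalSpace R]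
    [Module Rᵐᵒᵖ N] [FrechetModule Rᵐᵒᵖ N] [SMulCommClass A Rᵐᵒᵖ N] (r : Rᵐᵒᵖ)
    (t : ModTensor A M N) : r • t = ModTensor.map (ContinuousLinearMap.id ℂ M) (fun _ _ => rfl)
      (act r) (fun a y => (smul_comm a r y).symm) t := rfl

theorem ModTensor.smul_mk {R : Type*} [Ring R] [Algebra ℂ R] [TopologicalSpace R]
    [Module Rᵐᵒᵖ N] [FrechetModule Rᵐᵒᵖ N] [SMulCommClass A Rᵐᵒᵖ N] (r : Rᵐᵒᵖ) (x : M) (y : N) :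
    r • ModTensor.mk A M N x y = ModTensor.mk A M N x (r • y) :=
  ModTensor.map_mk _ _ _ _ x y

instance {R : Type*} [Ring R] [Algebra ℂ R] [TopologicalSpace R] [Module Rᵐᵒᵖ N]
    [FrechetModule Rᵐᵒᵖ N] [SMulCommClass A Rᵐᵒᵖ N] : Module Rᵐᵒᵖ (ModTensor A M N) :=
  Module.ofMinimalAxioms (fun r s t => by simp only [ModTensor.smul_def, map_add])
    (fun r s t => by
      simp only [ModTensor.smul_def]
      rw [← _root_.add_apply]
      refine congrArg (fun k : ModTensor A M N →L[ℂ] ModTensor A M N => k t)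
        (ModTensor.ext fun x y => ?_)
      change (r + s) • ModTensor.mk A M N x y
        = r • ModTensor.mk A M N x y + s • ModTensor.mk A M N x y
      rw [ModTensor.smul_mk, ModTensor.smul_mk, ModTensor.smul_mk, add_smul, map_add])
    (fun r s t => by
      simp only [ModTensor.smul_def]
      rw [← ContinuousLinearMap.comp_apply]
      refine congrArg (fun k : ModTensor A M N →L[ℂ] ModTensor A M N => k t)
        (ModTensor.ext fun x y => ?_)
      change (r * s) • ModTensor.mk A M N x y = r • s • ModTensor.mk A M N x y
      rw [ModTensor.smul_mk, ModTensor.smul_mk, ModTensor.smul_mk, mul_smul])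
    (fun t => by
      simp only [ModTensor.smul_def]
      refine congrArg (fun k : ModTensor A M N →L[ℂ] ModTensor A M N => k t)
        (ModTensor.ext (g := ContinuousLinearMap.id ℂ _) fun x y => ?_)
      change (1 : Rᵐᵒᵖ) • ModTensor.mk A M N x y = ModTensor.mk A M N x y
      rw [ModTensor.smul_mk, one_smul])

end ModuleTensor

section Forms

open MulOpposite

variable (A : Type*) [Ring A] [Algebra ℂ A] [TopologicalSpace A] [FrechetAlgebra A]

/-- The multiplication map `μ_A : A ⊗̂ A → A`, `a ⊗ b ↦ ab`. -/
def mulMap : CTensor A A →L[ℂ] A := CTensor.lift (LinearMap.mul ℂ A) continuous_mul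

@[simp]
theorem mulMap_mk (a b : A) : mulMap A (CTensor.mk A A a b) = a * b := CTensor.lift_mk _ _ a b

/-- The bimodule `Ω¹A` of noncommutative differential `1`-forms, realized as the kernel of the
multiplication map `A ⊗̂ A → A` (the universal derivation is `a ↦ 1 ⊗ a - a ⊗ 1`). -/
def formsSubmodule : Submodule ℂ (CTensor A A) := (mulMap A).toLinearMap.ker

instance : IsClosed (formsSubmodule A : Set (CTensor A A)) :=
  isClosed_singleton.preimage (mulMap A).continuous

/-- The bimodule `Ω¹A` as a type. -/
def Forms : Type _ := formsSubmodule A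

instance : AddCommGroup (Forms A) := inferInstanceAs (AddCommGroup (formsSubmodule A))
instance : Module ℂ (Forms A) := inferInstanceAs (Module ℂ (formsSubmodule A))
instance : TopologicalSpace (Forms A) := inferInstanceAs (TopologicalSpace (formsSubmodule A))
instance : FrechetSpace (Forms A) := inferInstanceAs (FrechetSpace (formsSubmodule A))

/-- The inclusion `j_A : Ω¹A → A ⊗̂ A`. -/
def Forms.incl : Forms A →L[ℂ] CTensor A A := (formsSubmodule A).subtypeL

variable {A}

theorem Forms.incl_injective : Function.Injective (Forms.incl A) := Subtype.val_injective

theorem Forms.isInducing_incl : IsInducing (Forms.incl A) := IsInducing.subtypeVal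

theorem Forms.mulMap_incl (w : Forms A) : mulMap A (Forms.incl A w) = 0 := w.2

theorem mulMap_actFst (a : A) (t : CTensor A A) :
    mulMap A (CTensor.actFst A A A a t) = a * mulMap A t :=
  CTensor.eq_of_mk ((mulMap A).continuous.comp (CTensor.continuous_actFst_right a))
    (continuous_const.mul (mulMap A).continuous) (by simp) (by simp [mul_add])
    (by simp [mul_assoc]) t

theorem mulMap_actSnd (a : Aᵐᵒᵖ) (t : CTensor A A) :
    mulMap A (CTensor.actSnd Aᵐᵒᵖ A A a t) = mulMap A t * a.unop :=
  CTensor.eq_of_mk ((mulMap A).continuous.comp (CTensor.continuous_actSnd_right a))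
    ((mulMap A).continuous.mul continuous_const) (by simp) (by simp [add_mul])
    (by simp [mul_assoc]) t

/-- The left action on `Ω¹A`: `a·(b ⊗ c) = ab ⊗ c`. -/
instance : SMul A (Forms A) where
  smul a w := ⟨CTensor.actFst A A A a (Forms.incl A w), by
    change mulMap A _ = 0
    rw [mulMap_actFst, Forms.mulMap_incl, mul_zero]⟩

/-- The right action on `Ω¹A`: `(b ⊗ c)·a = b ⊗ ca`. -/
instance : SMul Aᵐᵒᵖ (Forms A) where
  smul a w := ⟨CTensor.actSnd Aᵐᵒᵖ A A a (Forms.incl A w), by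
    change mulMap A _ = 0
    rw [mulMap_actSnd, Forms.mulMap_incl, zero_mul]⟩

theorem Forms.incl_smul (a : A) (w : Forms A) :
    Forms.incl A (a • w) = CTensor.actFst A A A a (Forms.incl A w) := rfl

theorem Forms.incl_op_smul (a : Aᵐᵒᵖ) (w : Forms A) :
    Forms.incl A (a • w) = CTensor.actSnd Aᵐᵒᵖ A A a (Forms.incl A w) := rfl

theorem Forms.ext {v w : Forms A} (h : Forms.incl A v = Forms.incl A w) : v = w :=
  Forms.incl_injective h

instance : Module A (Forms A) :=
  Module.ofMinimalAxioms
    (fun a v w => Forms.ext (by simp only [map_add, Forms.incl_smul]))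
    (fun a b w => Forms.ext (by
      simp only [map_add, Forms.incl_smul, LinearMap.add_apply]))
    (fun a b w => Forms.ext (by
      simp only [Forms.incl_smul]
      exact CTensor.eq_of_mk (CTensor.continuous_actFst_right _)
        ((CTensor.continuous_actFst_right _).comp (CTensor.continuous_actFst_right _))
        (by simp) (by simp) (by simp [mul_assoc]) (Forms.incl A w)))
    (fun w => Forms.ext (by
      simp only [Forms.incl_smul]
      exact CTensor.eq_of_mk (CTensor.continuous_actFst_right _) continuous_id
        (by simp) (by simp) (by simp) (Forms.incl A w)))

instance : Module Aᵐᵒᵖ (Forms A) :=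
  Module.ofMinimalAxioms
    (fun a v w => Forms.ext (by simp only [map_add, Forms.incl_op_smul]))
    (fun a b w => Forms.ext (by
      simp only [map_add, Forms.incl_op_smul, LinearMap.add_apply]))
    (fun a b w => Forms.ext (by
      simp only [Forms.incl_op_smul]
      exact CTensor.eq_of_mk (CTensor.continuous_actSnd_right _)
        ((CTensor.continuous_actSnd_right _).comp (CTensor.continuous_actSnd_right _))
        (by simp) (by simp) (by simp [mul_assoc]) (Forms.incl A w)))
    (fun w => Forms.ext (by
      simp only [Forms.incl_op_smul]
      exact CTensor.eq_of_mk (CTensor.continuous_actSnd_right _) continuous_id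
        (by simp) (by simp) (by simp) (Forms.incl A w)))

instance : FrechetModule A (Forms A) where
  smul_assoc c a w := Forms.ext (by simp [Forms.incl_smul])
  continuous_smul := by
    refine Forms.isInducing_incl.continuous_iff.2 ?_
    exact (CTensor.continuous_actFst (A := A) (M := A) (N := A)).comp
      (f := fun p : A × Forms A => (p.1, Forms.incl A p.2)) (by fun_prop)

instance : FrechetModule Aᵐᵒᵖ (Forms A) where
  smul_assoc c a w := Forms.ext (by simp [Forms.incl_op_smul])
  continuous_smul := by
    refine Forms.isInducing_incl.continuous_iff.2 ?_
    exact (CTensor.continuous_actSnd (A := Aᵐᵒᵖ) (M := A) (N := A)).comp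
      (f := fun p : Aᵐᵒᵖ × Forms A => (p.1, Forms.incl A p.2)) (by fun_prop)

instance : SMulCommClass A Aᵐᵒᵖ (Forms A) where
  smul_comm a b w := Forms.ext (by
    simp only [Forms.incl_op_smul, Forms.incl_smul]
    exact CTensor.eq_of_mk
      ((CTensor.continuous_actFst_right _).comp (CTensor.continuous_actSnd_right _))
      ((CTensor.continuous_actSnd_right _).comp (CTensor.continuous_actFst_right _))
      (by simp) (by simp) (by simp) (Forms.incl A w))

end Forms

section Homomorphism

open MulOpposite

variable {A B : Type*} [Ring A] [Algebra ℂ A] [TopologicalSpace A] [FrechetAlgebra A]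
  [Ring B] [Algebra ℂ B] [TopologicalSpace B] [FrechetAlgebra B]

/-- The Fréchet space `B`, viewed as a Fréchet `A`-bimodule through `φ : A → B`. -/
def Restrict (_φ : A →A[ℂ] B) : Type _ := B

variable (φ : A →A[ℂ] B)

set_option linter.unusedSectionVars false

instance : AddCommGroup (Restrict φ) := inferInstanceAs (AddCommGroup B)
instance : Module ℂ (Restrict φ) := inferInstanceAs (Module ℂ B)
instance : TopologicalSpace (Restrict φ) := inferInstanceAs (TopologicalSpace B)
instance : FrechetSpace (Restrict φ) := inferInstanceAs (FrechetSpace B)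

/-- The left action `a·b = φ(a)b`. -/
instance : Module A (Restrict φ) := Module.compHom B (φ : A →+* B)

/-- The right action `b·a = bφ(a)`. -/
instance : Module Aᵐᵒᵖ (Restrict φ) := Module.compHom B (RingHom.op (φ : A →+* B))

/-- The identity map from `B`, viewed as an `A`-bimodule, to `B`. -/
def Restrict.val : Restrict φ →L[ℂ] B := ContinuousLinearMap.id ℂ B

theorem Restrict.val_smul (a : A) (b : Restrict φ) :
    Restrict.val φ (a • b) = φ a * Restrict.val φ b := rfl

theorem Restrict.val_op_smul (a : A) (b : Restrict φ) :
    Restrict.val φ (op a • b) = Restrict.val φ b * φ a := rfl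

instance : FrechetModule A (Restrict φ) where
  smul_assoc c a x := by
    change φ (c • a) * Restrict.val φ x = c • (φ a * Restrict.val φ x)
    rw [map_smul, smul_mul_assoc]
  continuous_smul :=
    (φ.continuous.comp continuous_fst).mul ((Restrict.val φ).continuous.comp continuous_snd)

instance : FrechetModule Aᵐᵒᵖ (Restrict φ) where
  smul_assoc c a x := by
    change Restrict.val φ x * φ (c • a.unop) = c • (Restrict.val φ x * φ a.unop)
    rw [map_smul, mul_smul_comm]
  continuous_smul :=
    ((Restrict.val φ).continuous.comp continuous_snd).mul
      (φ.continuous.comp (continuous_unop.comp continuous_fst))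

/-- `φ` as a continuous linear map. -/
def homL : A →L[ℂ] B := ⟨(φ : A →ₐ[ℂ] B).toLinearMap, φ.continuous⟩

@[simp]
theorem homL_apply (a : A) : homL φ a = φ a := rfl

theorem mulMap_map (t : CTensor A A) :
    mulMap B (CTensor.map (homL φ) (homL φ) t) = φ (mulMap A t) :=
  CTensor.eq_of_mk ((mulMap B).continuous.comp (CTensor.map (homL φ) (homL φ)).continuous)
    (φ.continuous.comp (mulMap A).continuous) (by simp) (by simp) (by simp) t

/-- The map `Ω¹A → Ω¹B` that is the restriction of `φ ⊗̂ φ : A ⊗̂ A → B ⊗̂ B`; it sends `d_A(a)` to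
`d_B(φ(a))`. -/
def Forms.map : Forms A →L[ℂ] Forms B :=
  ((CTensor.map (homL φ) (homL φ)).comp (Forms.incl A)).codRestrict (formsSubmodule B) (fun w => by
    change mulMap B _ = 0
    rw [ContinuousLinearMap.comp_apply, mulMap_map, Forms.mulMap_incl, map_zero])

theorem Forms.incl_map (w : Forms A) :
    Forms.incl B (Forms.map φ w) = CTensor.map (homL φ) (homL φ) (Forms.incl A w) := rfl

theorem Forms.map_smul (a : A) (w : Forms A) : Forms.map φ (a • w) = φ a • Forms.map φ w :=
  Forms.ext (by
    simp only [Forms.incl_map, Forms.incl_smul]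
    exact CTensor.eq_of_mk
      ((CTensor.map (homL φ) (homL φ)).continuous.comp (CTensor.continuous_actFst_right _))
      ((CTensor.continuous_actFst_right _).comp (CTensor.map (homL φ) (homL φ)).continuous)
      (by simp) (by simp) (by simp) (Forms.incl A w))

theorem Forms.map_op_smul (a : A) (w : Forms A) :
    Forms.map φ (op a • w) = op (φ a) • Forms.map φ w :=
  Forms.ext (by
    simp only [Forms.incl_map, Forms.incl_op_smul]
    exact CTensor.eq_of_mk
      ((CTensor.map (homL φ) (homL φ)).continuous.comp (CTensor.continuous_actSnd_right _))
      ((CTensor.continuous_actSnd_right _).comp (CTensor.map (homL φ) (homL φ)).continuous)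
      (by simp) (by simp) (by simp) (Forms.incl A w))

/-- The space `B ⊗̂_A Ω¹A ⊗̂_A B`. -/
abbrev InducedForms : Type _ :=
  ModTensor A (ModTensor A (Restrict φ) (Forms A)) (Restrict φ)

/-- The map `B ⊗̂_A Ω¹A → Ω¹B`, `b ⊗ w ↦ b·(φ ⊗̂ φ)(w)`. -/
def leftInduced : ModTensor A (Restrict φ) (Forms A) →L[ℂ] Forms B :=
  ModTensor.lift
    (LinearMap.mk₂ ℂ (fun (b : Restrict φ) (w : Forms A) => Restrict.val φ b • Forms.map φ w)
      (fun b b' w => by rw [map_add, add_smul])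
      (fun c b w => by rw [_root_.map_smul, smul_assoc])
      (fun b w w' => by rw [map_add, smul_add])
      (fun c b w => by rw [_root_.map_smul, smul_algebra_smul_comm]))
    (((Restrict.val φ).continuous.comp continuous_fst).smul
      ((Forms.map φ).continuous.comp continuous_snd))
    (fun b a w => by
      simp only [LinearMap.mk₂_apply, Restrict.val_op_smul, Forms.map_smul, mul_smul])

theorem leftInduced_mk (b : Restrict φ) (w : Forms A) :
    leftInduced φ (ModTensor.mk A _ _ b w) = Restrict.val φ b • Forms.map φ w :=
  ModTensor.lift_mk _ _ _ b w

theorem leftInduced_op_smul (a : A) (t : ModTensor A (Restrict φ) (Forms A)) :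
    leftInduced φ (op a • t) = op (φ a) • leftInduced φ t := by
  have h : (leftInduced φ).comp (ModTensor.map (ContinuousLinearMap.id ℂ (Restrict φ))
      (fun _ _ => rfl) (act (op a)) (fun b y => (smul_comm b (op a) y).symm))
      = (act (op (φ a))).comp (leftInduced φ) := by
    refine ModTensor.ext fun b w => ?_
    change leftInduced φ (op a • ModTensor.mk A _ _ b w)
      = op (φ a) • leftInduced φ (ModTensor.mk A _ _ b w)
    rw [ModTensor.smul_mk, leftInduced_mk, leftInduced_mk, Forms.map_op_smul, smul_comm]
  exact congrArg (fun k => k t) h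

/-- The canonical `B`-bimodule map `B ⊗̂_A Ω¹A ⊗̂_A B → Ω¹B`, `b ⊗ w ⊗ c ↦ b·(φ ⊗̂ φ)(w)·c`. Its
composition with `Ω¹B ⊆ B ⊗̂ B` is obtained by applying `B ⊗̂_A (-) ⊗̂_A B` to `Ω¹A ⊆ A ⊗̂ A` and
identifying `B ⊗̂_A (A ⊗̂ A) ⊗̂_A B` with `B ⊗̂ B`. -/
def formsComparison : InducedForms φ →L[ℂ] Forms B :=
  ModTensor.lift
    (LinearMap.mk₂ ℂ (fun (t : ModTensor A (Restrict φ) (Forms A)) (c : Restrict φ) =>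
        op (Restrict.val φ c) • leftInduced φ t)
      (fun t t' c => by rw [map_add, smul_add])
      (fun k t c => by rw [_root_.map_smul, smul_algebra_smul_comm])
      (fun t c c' => by rw [map_add, op_add, add_smul])
      (fun k t c => by rw [_root_.map_smul, op_smul, smul_assoc]))
    ((continuous_op.comp ((Restrict.val φ).continuous.comp continuous_snd)).smul
      ((leftInduced φ).continuous.comp continuous_fst))
    (fun t a c => by
      simp only [LinearMap.mk₂_apply, Restrict.val_smul, leftInduced_op_smul, op_mul, mul_smul])

theorem formsComparison_mk (b : Restrict φ) (w : Forms A) (c : Restrict φ) :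
    formsComparison φ (ModTensor.mk A _ _ (ModTensor.mk A _ _ b w) c)
      = op (Restrict.val φ c) • Restrict.val φ b • Forms.map φ w := by
  rw [← leftInduced_mk]
  exact ModTensor.lift_mk _ _ _ _ c

/-- The map `A ⊗̂ B → B`, `a ⊗ c ↦ φ(a)c`. -/
def homMul : CTensor A B →L[ℂ] B :=
  (mulMap B).comp (CTensor.map (homL φ) (ContinuousLinearMap.id ℂ B))

/-- The map `B ⊗̂ (A ⊗̂ B) → B ⊗̂ B`, `b ⊗ (a ⊗ c) ↦ bφ(a) ⊗ c`. -/
def mulHomLeft : CTensor B (CTensor A B) →L[ℂ] CTensor B B :=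
  CTensor.lift ((CTensor.actFst B B B).compl₁₂ LinearMap.id
      (CTensor.map (homL φ) (ContinuousLinearMap.id ℂ B)).toLinearMap)
    ((CTensor.continuous_actFst (A := B) (M := B) (N := B)).comp
      (f := fun p : B × CTensor A B => (p.1, CTensor.map (homL φ) (ContinuousLinearMap.id ℂ B) p.2))
      (by fun_prop))

/-- The map `d_φ : B ⊗̂ A ⊗̂ B → B ⊗̂ B`, `b ⊗ a ⊗ c ↦ bφ(a) ⊗ c - b ⊗ φ(a)c`. -/
def dHom : CTensor B (CTensor A B) →L[ℂ] CTensor B B :=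
  mulHomLeft φ - CTensor.map (ContinuousLinearMap.id ℂ B) (homMul φ)

theorem dHom_mk (b : B) (a : A) (c : B) :
    dHom φ (CTensor.mk B _ b (CTensor.mk A B a c))
      = CTensor.mk B B (b * φ a) c - CTensor.mk B B b (φ a * c) := by
  have h1 : mulHomLeft φ (CTensor.mk B _ b (CTensor.mk A B a c))
      = CTensor.mk B B (b * φ a) c := by
    refine (CTensor.lift_mk _ _ _ _).trans ?_
    simp
  have h2 : homMul φ (CTensor.mk A B a c) = φ a * c := by simp [homMul]
  change mulHomLeft φ _ - CTensor.map _ _ _ = _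
  rw [h1, CTensor.map_mk, h2]
  rfl

end Homomorphism
section Tor

open MulOpposite

universe v

/-- A right Fréchet `A`-module, bundled. -/
structure RightMod (A : Type u) [Ring A] [Algebra ℂ A] [TopologicalSpace A] where
  carrier : Type u
  [addCommGroup : AddCommGroup carrier]
  [moduleC : Module ℂ carrier]
  [topology : TopologicalSpace carrier]
  [frechet : FrechetSpace carrier]
  [module : Module Aᵐᵒᵖ carrier]
  [frechetModule : FrechetModule Aᵐᵒᵖ carrier]

attribute [instance] RightMod.addCommGroup RightMod.moduleC RightMod.topology RightMod.frechet
  RightMod.module RightMod.frechetModule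

instance (A : Type u) [Ring A] [Algebra ℂ A] [TopologicalSpace A] :
    CoeSort (RightMod A) (Type u) := ⟨RightMod.carrier⟩

variable {A : Type u} [Ring A] [Algebra ℂ A] [TopologicalSpace A]

/-- A sequence `X → Y → Z` of right Fréchet `A`-modules is admissible (at `Y`) if it is a complex
that splits at `Y` in the category of topological vector spaces. -/
def AdmissibleAt {X Y Z : RightMod A} (i : X →L[Aᵐᵒᵖ] Y) (p : Y →L[Aᵐᵒᵖ] Z) : Prop :=
  (∀ x, p (i x) = 0) ∧
    ∃ (s : Y →L[ℂ] X) (t : Z →L[ℂ] Y), ∀ y, i (s y) + t (p y) = y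

/-- A right Fréchet `A`-module `P` is projective if the functor of continuous module morphisms
out of `P` takes admissible sequences to exact sequences of vector spaces. -/
def IsProjective (P : RightMod A) : Prop :=
  ∀ (X Y Z : RightMod A) (i : X →L[Aᵐᵒᵖ] Y) (p : Y →L[Aᵐᵒᵖ] Z), AdmissibleAt i p →
    ∀ f : P →L[Aᵐᵒᵖ] Y, (∀ x, p (f x) = 0) → ∃ g : P →L[Aᵐᵒᵖ] X, ∀ x, i (g x) = f x

/-- A projective resolution `0 ← M ← P₀ ← P₁ ← ⋯` in the category of right Fréchet `A`-modules:
a complex with projective `Pₙ` that has a contracting homotopy (`s₀`, `s`) consisting of continuous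
linear maps. -/
structure ProjectiveResolution (M : RightMod A) where
  P : ℕ → RightMod A
  d : ∀ n, P (n + 1) →L[Aᵐᵒᵖ] P n
  ε : P 0 →L[Aᵐᵒᵖ] M
  projective : ∀ n, IsProjective (P n)
  ε_d : ∀ x, ε (d 0 x) = 0
  d_d : ∀ n x, d n (d (n + 1) x) = 0
  admissible : ∃ (s₀ : M →L[ℂ] P 0) (s : ∀ n, P n →L[ℂ] P (n + 1)),
    (∀ x, ε (s₀ x) = x) ∧ (∀ x, d 0 (s 0 x) + s₀ (ε x) = x) ∧
      ∀ n x, d (n + 1) (s (n + 1) x) + s n (d n x) = x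

namespace ProjectiveResolution

variable {M : RightMod A} (R : ProjectiveResolution M)
variable (N : Type v) [AddCommGroup N] [Module ℂ N] [TopologicalSpace N] [FrechetSpace N]
  [Module A N]

/-- The differential `d ⊗̂_A id_N` of the complex `P ⊗̂_A N`. -/
def tensorD (n : ℕ) : ModTensor A (R.P (n + 1)) N →L[ℂ] ModTensor A (R.P n) N :=
  ModTensor.map ((R.d n).restrictScalars ℂ) (fun a x => (R.d n).map_smul (op a) x)
    (ContinuousLinearMap.id ℂ N) (fun _ _ => rfl)

/-- The `n`-cycles of the complex `P ⊗̂_A N`. -/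
def cycles : (n : ℕ) → Submodule ℂ (ModTensor A (R.P n) N)
  | 0 => ⊤
  | n + 1 => (R.tensorD N n).toLinearMap.ker

/-- The `n`-boundaries of the complex `P ⊗̂_A N`. -/
def boundaries (n : ℕ) : Submodule ℂ (ModTensor A (R.P n) N) := (R.tensorD N n).toLinearMap.range

/-- `Torₙ^A(M, N)`, the `n`th homology of `P ⊗̂_A N`, with its (possibly non-Hausdorff) quotient
topology. -/
abbrev Tor (n : ℕ) : Type _ :=
  R.cycles N n ⧸ (R.boundaries N n).comap (R.cycles N n).subtype

end ProjectiveResolution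

/-- `M` and `N` are `n`-transversal over `A`: for some (equivalently, each) projective resolution of
`M`, the spaces `Tor_m^A(M, N)` vanish for `1 ≤ m ≤ n`, and `Tor_0^A(M, N)` is Hausdorff. -/
def IsTransversal (n : ℕ) (M : RightMod A) (N : Type v) [AddCommGroup N] [Module ℂ N]
    [TopologicalSpace N] [FrechetSpace N] [Module A N] : Prop :=
  ∃ R : ProjectiveResolution M,
    (∀ m, 1 ≤ m → m ≤ n → Subsingleton (R.Tor N m)) ∧ T2Space (R.Tor N 0)

variable {B : Type u} [Ring B] [Algebra ℂ B] [TopologicalSpace B]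

/-- `φ` is an epimorphism in the category of Fréchet algebras and continuous (unital)
homomorphisms. -/
def IsEpimorphism (φ : A →A[ℂ] B) : Prop :=
  ∀ (C : Type u) [Ring C] [Algebra ℂ C] [TopologicalSpace C] [FrechetAlgebra C]
    (ψ ψ' : B →A[ℂ] C), ψ.comp φ = ψ'.comp φ → ψ = ψ'

/-- `φ : A → B` is `n`-pseudoflat if `B` and `B` are `n`-transversal over `A`. -/
def IsPseudoflat [FrechetAlgebra A] [FrechetAlgebra B] (n : ℕ) (φ : A →A[ℂ] B) : Prop :=
  IsTransversal n (RightMod.mk (A := A) (Restrict φ)) (Restrict φ)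

end Tor
end Frechet

end

/-! Everything is read off from the range of `dHom φ` inside `B ⊗̂ B`. Since `μ_B ∘ d_φ = 0`, this
range lies in the closed subspace `Ω¹B`. Pseudoflatness says that the range is closed, the
epimorphism property says that it is dense in `Ω¹B`, and together they say that it equals `Ω¹B`. The
last condition is exactness at `B ⊗̂ B`, and it is also surjectivity of the comparison map of forms.

Closedness (`isPseudoflat_zero_iff`): `Tor₀` is Hausdorff iff the first differential of the tensored
resolution has closed range, and this does not depend on the resolution
(`ProjectiveResolution.isClosed_range_tensorD`). For the resolution by free modules over iterated
syzygies, `(M ⊗̂ A) ⊗̂_A N ≅ M ⊗̂ N` turns the range into that of the bar differential, which for `M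
= N = B` is `d_φ` up to reassociation.

Density (`isEpimorphism_iff`): if `ψ ∘ φ = ψ' ∘ φ`, then `b ⊗ c ↦ ψ(b)ψ'(c)` kills the range of
`d_φ`; under density it kills `1 ⊗ b - b ⊗ 1`, so `ψ = ψ'`. Conversely, the universal derivation of
`B`, taken modulo the closure of the range, vanishes on `φ(A)`. It therefore yields a homomorphism
into a square-zero extension that agrees on `φ(A)` with the trivial one. For an epimorphism the
derivation is zero, and its values generate `Ω¹B`.

Comparison map (`range_incl_formsComparison`): `b ⊗ da ⊗ c` is sent to `-d_φ(b ⊗ a ⊗ c)`, so the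
comparison map and `d_φ` have the same range in `B ⊗̂ B`. -/

noncomputable section

namespace Frechet

set_option linter.unusedSectionVars false

open TensorProduct Topology Filter Set Pointwise MulOpposite

/-! ### Associativity of the completed projective tensor product. -/

section Associativity

variable {X Y Z : Type*}
  [AddCommGroup X] [Module ℂ X] [TopologicalSpace X] [FrechetSpace X]
  [AddCommGroup Y] [Module ℂ Y] [TopologicalSpace Y] [FrechetSpace Y]
  [AddCommGroup Z] [Module ℂ Z] [TopologicalSpace Z] [FrechetSpace Z]

/-- The map `y ↦ x ⊗ y`. -/
def CTensor.mkL (x : X) : Y →L[ℂ] CTensor X Y :=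
  ⟨CTensor.mk X Y x, (CTensor.continuous_mk X Y).comp (by fun_prop : Continuous fun y : Y => (x, y))⟩

/-- The map `x ↦ x ⊗ y`. -/
def CTensor.mkR (y : Y) : X →L[ℂ] CTensor X Y :=
  ⟨(CTensor.mk X Y).flip y,
    (CTensor.continuous_mk X Y).comp (by fun_prop : Continuous fun x : X => (x, y))⟩

@[simp]
theorem CTensor.mkL_apply (x : X) (y : Y) : CTensor.mkL x y = CTensor.mk X Y x y := rfl

@[simp]
theorem CTensor.mkR_apply (x : X) (y : Y) : CTensor.mkR y x = CTensor.mk X Y x y := rfl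

/-- The bilinear map `(z, x ⊗ y) ↦ x ⊗ (y ⊗ z)`. -/
def CTensor.assocAux (X Y Z : Type*)
    [AddCommGroup X] [Module ℂ X] [TopologicalSpace X] [FrechetSpace X]
    [AddCommGroup Y] [Module ℂ Y] [TopologicalSpace Y] [FrechetSpace Y]
    [AddCommGroup Z] [Module ℂ Z] [TopologicalSpace Z] [FrechetSpace Z] :
    Z →ₗ[ℂ] CTensor X Y →ₗ[ℂ] CTensor X (CTensor Y Z) where
  toFun z := (CTensor.map (ContinuousLinearMap.id ℂ X) (CTensor.mkR z)).toLinearMap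
  map_add' z z' := by
    rw [← ContinuousLinearMap.toLinearMap_add]
    congr 1
    exact CTensor.ext fun x y => by simp
  map_smul' c z := by
    rw [RingHom.id_apply, ← ContinuousLinearMap.toLinearMap_smul]
    congr 1
    exact CTensor.ext fun x y => by simp

theorem CTensor.assocAux_mk (x : X) (y : Y) (z : Z) :
    CTensor.assocAux X Y Z z (CTensor.mk X Y x y) = CTensor.mk X _ x (CTensor.mk Y Z y z) :=
  CTensor.map_mk _ _ x y

/-- Joint continuity is what `CTensor.lift` requires; `CTensor.continuous_of_trilinear` reduces it
to the trilinear map on `Z × X × Y`. -/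
theorem CTensor.continuous_assocAux :
    Continuous fun p : Z × CTensor X Y => CTensor.assocAux X Y Z p.1 p.2 := by
  refine CTensor.continuous_of_trilinear _
    (fun z => (CTensor.map (ContinuousLinearMap.id ℂ X) (CTensor.mkR z)).continuous) ?_
  simp only [CTensor.assocAux_mk]
  exact (CTensor.continuous_mk X (CTensor Y Z)).comp
    (f := fun p : Z × X × Y => (p.2.1, CTensor.mk Y Z p.2.2 p.1))
    ((by fun_prop : Continuous fun p : Z × X × Y => p.2.1).prodMk
      ((CTensor.continuous_mk Y Z).comp
        (f := fun p : Z × X × Y => (p.2.2, p.1)) (by fun_prop)))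

/-- The associativity map `(X ⊗̂ Y) ⊗̂ Z → X ⊗̂ (Y ⊗̂ Z)`. -/
def CTensor.assoc (X Y Z : Type*)
    [AddCommGroup X] [Module ℂ X] [TopologicalSpace X] [FrechetSpace X]
    [AddCommGroup Y] [Module ℂ Y] [TopologicalSpace Y] [FrechetSpace Y]
    [AddCommGroup Z] [Module ℂ Z] [TopologicalSpace Z] [FrechetSpace Z] :
    CTensor (CTensor X Y) Z →L[ℂ] CTensor X (CTensor Y Z) :=
  CTensor.lift (CTensor.assocAux X Y Z).flip
    (CTensor.continuous_assocAux.comp (f := fun p : CTensor X Y × Z => (p.2, p.1)) (by fun_prop))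

@[simp]
theorem CTensor.assoc_mk (x : X) (y : Y) (z : Z) :
    CTensor.assoc X Y Z (CTensor.mk _ Z (CTensor.mk X Y x y) z)
      = CTensor.mk X _ x (CTensor.mk Y Z y z) :=
  (CTensor.lift_mk _ _ _ _).trans (CTensor.assocAux_mk x y z)

/-- The bilinear map `(x, y ⊗ z) ↦ (x ⊗ y) ⊗ z`. -/
def CTensor.assocInvAux (X Y Z : Type*)
    [AddCommGroup X] [Module ℂ X] [TopologicalSpace X] [FrechetSpace X]
    [AddCommGroup Y] [Module ℂ Y] [TopologicalSpace Y] [FrechetSpace Y]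
    [AddCommGroup Z] [Module ℂ Z] [TopologicalSpace Z] [FrechetSpace Z] :
    X →ₗ[ℂ] CTensor Y Z →ₗ[ℂ] CTensor (CTensor X Y) Z where
  toFun x := (CTensor.map (CTensor.mkL x) (ContinuousLinearMap.id ℂ Z)).toLinearMap
  map_add' z z' := by
    rw [← ContinuousLinearMap.toLinearMap_add]
    congr 1
    exact CTensor.ext fun x y => by simp
  map_smul' c z := by
    rw [RingHom.id_apply, ← ContinuousLinearMap.toLinearMap_smul]
    congr 1
    exact CTensor.ext fun x y => by simp

theorem CTensor.assocInvAux_mk (x : X) (y : Y) (z : Z) :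
    CTensor.assocInvAux X Y Z x (CTensor.mk Y Z y z) = CTensor.mk _ Z (CTensor.mk X Y x y) z :=
  CTensor.map_mk _ _ y z

theorem CTensor.continuous_assocInvAux :
    Continuous fun p : X × CTensor Y Z => CTensor.assocInvAux X Y Z p.1 p.2 := by
  refine CTensor.continuous_of_trilinear _
    (fun x => (CTensor.map (CTensor.mkL x) (ContinuousLinearMap.id ℂ Z)).continuous) ?_
  simp only [CTensor.assocInvAux_mk]
  exact (CTensor.continuous_mk (CTensor X Y) Z).comp
    (f := fun p : X × Y × Z => (CTensor.mk X Y p.1 p.2.1, p.2.2))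
    (((CTensor.continuous_mk X Y).comp
      (f := fun p : X × Y × Z => (p.1, p.2.1)) (by fun_prop)).prodMk (by fun_prop))

/-- The associativity map `X ⊗̂ (Y ⊗̂ Z) → (X ⊗̂ Y) ⊗̂ Z`. -/
def CTensor.assocInv (X Y Z : Type*)
    [AddCommGroup X] [Module ℂ X] [TopologicalSpace X] [FrechetSpace X]
    [AddCommGroup Y] [Module ℂ Y] [TopologicalSpace Y] [FrechetSpace Y]
    [AddCommGroup Z] [Module ℂ Z] [TopologicalSpace Z] [FrechetSpace Z] :
    CTensor X (CTensor Y Z) →L[ℂ] CTensor (CTensor X Y) Z :=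
  CTensor.lift (CTensor.assocInvAux X Y Z) CTensor.continuous_assocInvAux

@[simp]
theorem CTensor.assocInv_mk (x : X) (y : Y) (z : Z) :
    CTensor.assocInv X Y Z (CTensor.mk X _ x (CTensor.mk Y Z y z))
      = CTensor.mk _ Z (CTensor.mk X Y x y) z :=
  (CTensor.lift_mk _ _ _ _).trans (CTensor.assocInvAux_mk x y z)

/-- Continuous linear maps on `(X ⊗̂ Y) ⊗̂ Z` are determined by elementary tensors. -/
theorem CTensor.ext_left {E : Type*} [AddCommGroup E] [Module ℂ E] [TopologicalSpace E] [T2Space E]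
    {f g : CTensor (CTensor X Y) Z →L[ℂ] E}
    (h : ∀ x y z, f (CTensor.mk _ Z (CTensor.mk X Y x y) z)
      = g (CTensor.mk _ Z (CTensor.mk X Y x y) z)) : f = g := by
  refine CTensor.ext fun t z => ?_
  have : f.comp (CTensor.mkR z) = g.comp (CTensor.mkR z) := CTensor.ext fun x y => h x y z
  exact congrArg (fun k => k t) this

/-- Continuous linear maps on `X ⊗̂ (Y ⊗̂ Z)` are determined by elementary tensors. -/
theorem CTensor.ext_right {E : Type*} [AddCommGroup E] [Module ℂ E] [TopologicalSpace E]
    [T2Space E] {f g : CTensor X (CTensor Y Z) →L[ℂ] E}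
    (h : ∀ x y z, f (CTensor.mk X _ x (CTensor.mk Y Z y z))
      = g (CTensor.mk X _ x (CTensor.mk Y Z y z))) : f = g := by
  refine CTensor.ext fun x t => ?_
  have : f.comp (CTensor.mkL x) = g.comp (CTensor.mkL x) := CTensor.ext fun y z => h x y z
  exact congrArg (fun k => k t) this

theorem CTensor.assoc_assocInv (t : CTensor X (CTensor Y Z)) :
    CTensor.assoc X Y Z (CTensor.assocInv X Y Z t) = t := by
  have : (CTensor.assoc X Y Z).comp (CTensor.assocInv X Y Z) = ContinuousLinearMap.id ℂ _ :=
    CTensor.ext_right fun x y z => by simp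
  exact congrArg (fun k => k t) this

/-- The only consequence of associativity needed later: precomposing a map with `CTensor.assoc`
leaves its range unchanged. -/
theorem CTensor.assoc_surjective : Function.Surjective (CTensor.assoc X Y Z) :=
  fun t => ⟨_, CTensor.assoc_assocInv t⟩

end Associativity

/-! ### Module actions as linear maps, and the bar differential. -/

section LeftAction

variable (A : Type*) [Ring A] [Algebra ℂ A] [TopologicalSpace A] [FrechetAlgebra A]
variable (M : Type*) [AddCommGroup M] [Module ℂ M] [TopologicalSpace M] [FrechetSpace M]
variable (N : Type*) [AddCommGroup N] [Module ℂ N] [TopologicalSpace N] [FrechetSpace N]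
  [Module A N] [FrechetModule A N]

/-- The left action `A ⊗̂ N → N`, `a ⊗ n ↦ a·n`. -/
def leftAct : CTensor A N →L[ℂ] N :=
  CTensor.lift (LinearMap.mk₂ ℂ (fun (a : A) (n : N) => a • n)
      (fun a a' n => add_smul a a' n)
      (fun c a n => smul_assoc c a n)
      (fun a n n' => smul_add a n n')
      (fun c a n => smul_algebra_smul_comm c a n))
    (continuous_fst.smul continuous_snd)

@[simp]
theorem leftAct_mk (a : A) (n : N) : leftAct A N (CTensor.mk A N a n) = a • n :=
  CTensor.lift_mk _ _ a n

/-- The map `(M ⊗̂ A) ⊗̂ N → M ⊗̂ N`, `(m ⊗ a) ⊗ n ↦ m ⊗ a·n`. -/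
def innerAct : CTensor (CTensor M A) N →L[ℂ] CTensor M N :=
  (CTensor.map (ContinuousLinearMap.id ℂ M) (leftAct A N)).comp (CTensor.assoc M A N)

@[simp]
theorem innerAct_mk (m : M) (a : A) (n : N) :
    innerAct A M N (CTensor.mk _ N (CTensor.mk M A m a) n) = CTensor.mk M N m (a • n) := by
  simp [innerAct]

end LeftAction

section Bar

variable (A : Type*) [Ring A] [Algebra ℂ A] [TopologicalSpace A] [FrechetAlgebra A]
variable (M : Type*) [AddCommGroup M] [Module ℂ M] [TopologicalSpace M] [FrechetSpace M]
  [Module Aᵐᵒᵖ M] [FrechetModule Aᵐᵒᵖ M]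
variable (N : Type*) [AddCommGroup N] [Module ℂ N] [TopologicalSpace N] [FrechetSpace N]
  [Module A N] [FrechetModule A N]

/-- The right action `M ⊗̂ A → M`, `m ⊗ a ↦ m·a`. -/
def rightAct : CTensor M A →L[ℂ] M :=
  CTensor.lift (LinearMap.mk₂ ℂ (fun (m : M) (a : A) => op a • m)
      (fun m m' a => smul_add _ m m')
      (fun c m a => smul_algebra_smul_comm c (op a) m)
      (fun m a a' => by rw [op_add, add_smul])
      (fun c m a => by rw [op_smul, smul_assoc]))
    ((continuous_op.comp continuous_snd).smul continuous_fst)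

@[simp]
theorem rightAct_mk (m : M) (a : A) : rightAct A M (CTensor.mk M A m a) = op a • m :=
  CTensor.lift_mk _ _ m a

/-- The bar differential `(M ⊗̂ A) ⊗̂ N → M ⊗̂ N`, `(m ⊗ a) ⊗ n ↦ m·a ⊗ n - m ⊗ a·n`. -/
def barD : CTensor (CTensor M A) N →L[ℂ] CTensor M N :=
  CTensor.map (rightAct A M) (ContinuousLinearMap.id ℂ N) - innerAct A M N

@[simp]
theorem barD_mk (m : M) (a : A) (n : N) :
    barD A M N (CTensor.mk _ N (CTensor.mk M A m a) n)
      = CTensor.mk M N (op a • m) n - CTensor.mk M N m (a • n) := by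
  simp [barD]

end Bar

/-! ### Free right modules and the canonical free resolution. -/

section FreeModules

variable {A : Type u} [Ring A] [Algebra ℂ A] [TopologicalSpace A] [FrechetAlgebra A]

section

variable (E : Type*) [AddCommGroup E] [Module ℂ E] [TopologicalSpace E] [FrechetSpace E]

/-- The right action of `A` on `E ⊗̂ A`, `(e ⊗ b)·a = e ⊗ ba`. -/
instance : SMul Aᵐᵒᵖ (CTensor E A) where
  smul a t := CTensor.actSnd Aᵐᵒᵖ E A a t

variable {E}

theorem CTensor.op_smul_def (a : Aᵐᵒᵖ) (t : CTensor E A) :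
    a • t = CTensor.actSnd Aᵐᵒᵖ E A a t := rfl

theorem CTensor.op_smul_mk (a : Aᵐᵒᵖ) (e : E) (b : A) :
    a • CTensor.mk E A e b = CTensor.mk E A e (a • b) := CTensor.actSnd_mk a e b

instance : Module Aᵐᵒᵖ (CTensor E A) :=
  Module.ofMinimalAxioms
    (fun a v w => by simp only [CTensor.op_smul_def, map_add])
    (fun a b w => by simp only [CTensor.op_smul_def, map_add, LinearMap.add_apply])
    (fun a b w => by
      simp only [CTensor.op_smul_def]
      exact CTensor.eq_of_mk (CTensor.continuous_actSnd_right _)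
        ((CTensor.continuous_actSnd_right _).comp (CTensor.continuous_actSnd_right _))
        (by simp) (by simp) (by simp [mul_assoc]) w)
    (fun w => by
      simp only [CTensor.op_smul_def]
      exact CTensor.eq_of_mk (CTensor.continuous_actSnd_right _) continuous_id
        (by simp) (by simp) (by simp) w)

instance : FrechetModule Aᵐᵒᵖ (CTensor E A) where
  smul_assoc c a w := by simp [CTensor.op_smul_def]
  continuous_smul := CTensor.continuous_actSnd (A := Aᵐᵒᵖ) (M := E) (N := A)

/-- Additive continuous maps between right modules out of `E ⊗̂ A` that are `A`-equivariant on
elementary tensors are `A`-equivariant. -/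
theorem CTensor.map_op_smul_of_mk {Y : Type*} [AddCommGroup Y] [Module ℂ Y] [TopologicalSpace Y]
    [FrechetSpace Y] [Module Aᵐᵒᵖ Y] [FrechetModule Aᵐᵒᵖ Y] (f : CTensor E A →L[ℂ] Y)
    (h : ∀ e b (a : Aᵐᵒᵖ), f (CTensor.mk E A e (a • b)) = a • f (CTensor.mk E A e b))
    (a : Aᵐᵒᵖ) (t : CTensor E A) : f (a • t) = a • f t := by
  have : f.comp (act a) = (act a).comp f := CTensor.ext fun e b => by
    rw [ContinuousLinearMap.comp_apply, act_apply, CTensor.op_smul_mk, h]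
    rfl
  exact congrArg (fun k => k t) this

end

/-- The free right Fréchet module `E ⊗̂ A`. -/
abbrev freeMod (A : Type u) [Ring A] [Algebra ℂ A] [TopologicalSpace A] [FrechetAlgebra A]
    (E : Type u) [AddCommGroup E] [Module ℂ E] [TopologicalSpace E] [FrechetSpace E] : RightMod A :=
  RightMod.mk (CTensor E A)

/-- The module morphism `E ⊗̂ A → Y`, `e ⊗ a ↦ f(e)·a`, extending `f : E → Y`. -/
def freeLift {E : Type u} [AddCommGroup E] [Module ℂ E] [TopologicalSpace E] [FrechetSpace E]
    {Y : RightMod A} (f : E →L[ℂ] Y) : freeMod A E →L[Aᵐᵒᵖ] Y where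
  toFun := (rightAct A Y).comp (CTensor.map f (ContinuousLinearMap.id ℂ A))
  map_add' := map_add _
  map_smul' := CTensor.map_op_smul_of_mk _ fun e b a => by simp [mul_smul]
  cont := ((rightAct A Y).comp (CTensor.map f (ContinuousLinearMap.id ℂ A))).continuous

@[simp]
theorem freeLift_mk {E : Type u} [AddCommGroup E] [Module ℂ E] [TopologicalSpace E]
    [FrechetSpace E] {Y : RightMod A} (f : E →L[ℂ] Y) (e : E) (a : A) :
    freeLift f (CTensor.mk E A e a) = op a • f e := by
  change rightAct A Y (CTensor.map f (ContinuousLinearMap.id ℂ A) (CTensor.mk E A e a)) = _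
  simp

/-- Every elementary tensor is a translate `e ⊗ a = (e ⊗ 1)·a`, so equivariance propagates agreement
from the generators `e ⊗ 1`. -/
theorem freeMod_hom_ext {E : Type u} [AddCommGroup E] [Module ℂ E] [TopologicalSpace E]
    [FrechetSpace E] {Y : RightMod A} {f g : freeMod A E →L[Aᵐᵒᵖ] Y}
    (h : ∀ e, f (CTensor.mk E A e 1) = g (CTensor.mk E A e 1)) (t : CTensor E A) : f t = g t := by
  refine CTensor.eq_of_mk (M := E) (N := A) f.continuous g.continuous (map_add f) (map_add g)
    (fun e a => ?_) t
  have : CTensor.mk E A e a = op a • CTensor.mk E A e 1 := by simp [CTensor.op_smul_mk]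
  rw [this]
  exact (f.map_smul _ _).trans ((congrArg _ (h e)).trans (g.map_smul _ _).symm)

/-- Any continuous linear map on `E` extends to a module morphism on `E ⊗̂ A`. A merely linear
splitting `s` is therefore enough to lift: apply it on generators and extend. -/
theorem isProjective_freeMod (E : Type u) [AddCommGroup E] [Module ℂ E] [TopologicalSpace E]
    [FrechetSpace E] : IsProjective (freeMod A E) := by
  rintro X Y Z i p ⟨-, s, t, hst⟩ f hf
  refine ⟨freeLift (s.comp ((f.restrictScalars ℂ).comp (CTensor.mkR (1 : A)))), ?_⟩
  refine freeMod_hom_ext (f := i.comp _) fun e => ?_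
  -- Because `p ∘ f = 0`, the splitting identity collapses to `i (s (f (e ⊗ 1))) = f (e ⊗ 1)`.
  have h := hst (f (CTensor.mk E A e 1))
  rw [hf, map_zero, add_zero] at h
  refine (congrArg i ((freeLift_mk _ e 1).trans ?_)).trans h
  rw [op_one, one_smul]
  rfl

/-- The kernel of the action map `X ⊗̂ A → X`, as a right module. -/
def syzygy (X : RightMod A) : RightMod A :=
  let K : Submodule Aᵐᵒᵖ (CTensor X A) :=
    LinearMap.ker (freeLift (ContinuousLinearMap.id ℂ X)).toLinearMap
  -- The Fréchet structure is inherited by closed complex subspaces, so the `Aᵐᵒᵖ`-submodule is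
  -- first regarded over `ℂ`.
  have : IsClosed ((K.restrictScalars ℂ : Submodule ℂ (CTensor X A)) : Set (CTensor X A)) :=
    isClosed_singleton.preimage (freeLift (ContinuousLinearMap.id ℂ X)).continuous
  have : FrechetSpace K := inferInstanceAs (FrechetSpace (K.restrictScalars ℂ))
  have : FrechetModule Aᵐᵒᵖ K := { }
  RightMod.mk K


/-- The inclusion of the syzygy module into the free module. -/
def syzygyIncl (X : RightMod A) : syzygy X →L[Aᵐᵒᵖ] freeMod A X :=
  (LinearMap.ker (freeLift (ContinuousLinearMap.id ℂ X)).toLinearMap).subtypeL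

theorem syzygyIncl_injective (X : RightMod A) : Function.Injective (syzygyIncl X) :=
  Subtype.val_injective

/-- The action map `X ⊗̂ A → X` as a module morphism. -/
def freeCover (X : RightMod A) : freeMod A X →L[Aᵐᵒᵖ] X := freeLift (ContinuousLinearMap.id ℂ X)

@[simp]
theorem freeCover_mk (X : RightMod A) (x : X) (a : A) :
    freeCover X (CTensor.mk X A x a) = op a • x := freeLift_mk _ x a

theorem freeCover_syzygyIncl (X : RightMod A) (k : syzygy X) :
    freeCover X (syzygyIncl X k) = 0 := k.2

/-- The linear section `x ↦ x ⊗ 1` of the action map. -/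
def freeUnit (X : RightMod A) : X →L[ℂ] freeMod A X := CTensor.mkR (1 : A)

theorem freeUnit_apply (X : RightMod A) (x : X) : freeUnit X x = CTensor.mk X A x 1 := rfl

theorem freeCover_freeUnit (X : RightMod A) (x : X) : freeCover X (freeUnit X x) = x := by
  rw [freeUnit_apply, freeCover_mk, op_one, one_smul]

/-- The linear projection `t ↦ t - μ(t) ⊗ 1` onto the syzygy module. -/
def syzygyProj (X : RightMod A) : freeMod A X →L[ℂ] syzygy X :=
  (ContinuousLinearMap.id ℂ (freeMod A X)
      - (freeUnit X).comp ((freeCover X).restrictScalars ℂ)).codRestrict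
    ((LinearMap.ker (freeLift (ContinuousLinearMap.id ℂ X)).toLinearMap).restrictScalars ℂ)
    (fun t => by
      change freeCover X (t - freeUnit X (freeCover X t)) = 0
      rw [map_sub, freeCover_freeUnit, sub_self])

theorem syzygyIncl_proj (X : RightMod A) (t : freeMod A X) :
    syzygyIncl X (syzygyProj X t) = t - freeUnit X (freeCover X t) := rfl

theorem syzygyProj_incl (X : RightMod A) (k : syzygy X) : syzygyProj X (syzygyIncl X k) = k :=
  syzygyIncl_injective X (by rw [syzygyIncl_proj, freeCover_syzygyIncl, map_zero, sub_zero])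

/-- The sequence of the syzygy, the free module and `X` splits linearly through `x ↦ x ⊗ 1`.
Splicing these splittings gives the contracting homotopy; this identity is its degree-zero case and,
for iterated syzygies, all the others. -/
theorem freeCover_homotopy (X : RightMod A) (t : freeMod A X) :
    syzygyIncl X (freeCover (syzygy X) (freeUnit (syzygy X) (syzygyProj X t)))
      + freeUnit X (freeCover X t) = t := by
  rw [freeCover_freeUnit, syzygyIncl_proj, sub_add_cancel]

/-- The iterated syzygy modules. -/
def syzygies (X : RightMod A) : ℕ → RightMod A
  | 0 => X
  | n + 1 => syzygy (syzygies X n)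

/-- The canonical resolution of a right module by free modules. -/
def freeResolution (X : RightMod A) : ProjectiveResolution X where
  P n := freeMod A (syzygies X n)
  d n := (syzygyIncl (syzygies X n)).comp (freeCover (syzygies X (n + 1)))
  ε := freeCover X
  projective _ := isProjective_freeMod _
  ε_d x := freeCover_syzygyIncl X _
  d_d n x := by
    refine (congrArg (syzygyIncl (syzygies X n)) ?_).trans (map_zero _)
    exact freeCover_syzygyIncl (syzygies X (n + 1)) _
  admissible := by
    refine ⟨freeUnit X, fun n => (freeUnit (syzygies X (n + 1))).comp (syzygyProj (syzygies X n)),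
      freeCover_freeUnit X, freeCover_homotopy X, fun n x => ?_⟩
    -- In `s n (d n x)` the projection `syzygyProj` undoes `syzygyIncl`, which leaves the splitting
    -- identity for the next syzygy.
    refine Eq.trans ?_ (freeCover_homotopy (syzygies X (n + 1)) x)
    exact congrArg (fun k => _ + freeUnit (syzygies X (n + 1)) k)
      (syzygyProj_incl (syzygies X n) (freeCover (syzygies X (n + 1)) x))

end FreeModules

/-! ### Independence of the projective resolution. -/

section Comparison

universe v

variable {A : Type u} [Ring A] [Algebra ℂ A] [TopologicalSpace A] {M : RightMod A}
variable (N : Type v) [AddCommGroup N] [Module ℂ N] [TopologicalSpace N] [FrechetSpace N]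
  [Module A N]

/-- `f ⊗̂_A N` for a morphism `f` of right modules. -/
def tensorRight {X Y : RightMod A} (f : X →L[Aᵐᵒᵖ] Y) : ModTensor A X N →L[ℂ] ModTensor A Y N :=
  ModTensor.map (f.restrictScalars ℂ) (fun a x => f.map_smul (op a) x)
    (ContinuousLinearMap.id ℂ N) (fun _ _ => rfl)

@[simp]
theorem tensorRight_mk {X Y : RightMod A} (f : X →L[Aᵐᵒᵖ] Y) (x : X) (n : N) :
    tensorRight N f (ModTensor.mk A X N x n) = ModTensor.mk A Y N (f x) n :=
  ModTensor.map_mk _ _ _ _ x n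

theorem ProjectiveResolution.tensorD_zero_mk (R : ProjectiveResolution M) (x : R.P 1) (n : N) :
    R.tensorD N 0 (ModTensor.mk A (R.P 1) N x n) = ModTensor.mk A (R.P 0) N (R.d 0 x) n :=
  ModTensor.map_mk _ _ _ _ x n

theorem isClosed_of_t2Space_quotient {E : Type*} [AddCommGroup E] [Module ℂ E]
    [TopologicalSpace E] (S : Submodule ℂ E) [T2Space (E ⧸ S)] : IsClosed (S : Set E) := by
  have : (S : Set E) = S.mkQ ⁻¹' {0} := by
    ext x
    simp
  have hq : Continuous S.mkQ := continuous_quot_mk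
  rw [this]
  exact isClosed_singleton.preimage hq

/-- All of degree zero consists of cycles, so `Tor₀` is the quotient by the range of the first
differential; a quotient of a topological vector space is Hausdorff exactly when the subspace is
closed. -/
theorem ProjectiveResolution.t2Space_tor_zero_iff (R : ProjectiveResolution M) :
    T2Space (R.Tor N 0) ↔ IsClosed (Set.range (R.tensorD N 0)) := by
  have hr : Set.range (R.tensorD N 0) = (R.boundaries N 0 : Set (ModTensor A (R.P 0) N)) := rfl
  rw [hr]
  constructor
  · intro h
    have h1 := isClosed_of_t2Space_quotient ((R.boundaries N 0).comap (R.cycles N 0).subtype)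
    have h2 : Continuous fun x : ModTensor A (R.P 0) N => (⟨x, trivial⟩ : R.cycles N 0) := by
      fun_prop
    exact h1.preimage h2
  · intro h
    have h1 : IsClosed (((R.boundaries N 0).comap (R.cycles N 0).subtype : Submodule ℂ _) :
        Set (R.cycles N 0)) := h.preimage continuous_subtype_val
    have : T3Space (R.Tor N 0) := Submodule.t3_quotient_of_isClosed
      ((R.boundaries N 0).comap (R.cycles N 0).subtype)
    infer_instance

/-- Closedness of the range of the first differential does not depend on the resolution. -/
theorem ProjectiveResolution.isClosed_range_tensorD (R R' : ProjectiveResolution M)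
    (h : IsClosed (Set.range (R.tensorD N 0))) : IsClosed (Set.range (R'.tensorD N 0)) := by
  -- The augmentation is a linearly split surjection, which is admissibility of the pair `(R'.ε,
  -- 0)`.
  have lift₀ : ∀ R R' : ProjectiveResolution M,
      ∃ f : R.P 0 →L[Aᵐᵒᵖ] R'.P 0, ∀ x, R'.ε (f x) = R.ε x := fun R R' => by
    obtain ⟨s₀, -, h0, -⟩ := R'.admissible
    exact R.projective 0 _ M M R'.ε 0 ⟨fun _ => rfl, s₀, 0, by simpa using h0⟩ R.ε (fun _ => rfl)
  -- A morphism from a projective that is killed by the augmentation factors through `d 0`.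
  have lift₁ : ∀ (P : RightMod A) (_ : IsProjective P) (R : ProjectiveResolution M)
      (f : P →L[Aᵐᵒᵖ] R.P 0) (_ : ∀ x, R.ε (f x) = 0),
      ∃ g : P →L[Aᵐᵒᵖ] R.P 1, ∀ x, R.d 0 (g x) = f x := fun P hP R f hf => by
    obtain ⟨s₀, s, -, h1, -⟩ := R.admissible
    exact hP _ _ _ (R.d 0) R.ε ⟨R.ε_d, s 0, s₀, h1⟩ f hf
  obtain ⟨f0, hf0⟩ := lift₀ R R'
  obtain ⟨g0, hg0⟩ := lift₀ R' R
  obtain ⟨f1, hf1⟩ := lift₁ _ (R.projective 1) R' (f0.comp (R.d 0))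
    (fun x => by rw [ContinuousLinearMap.comp_apply, hf0, R.ε_d])
  obtain ⟨g1, hg1⟩ := lift₁ _ (R'.projective 1) R (g0.comp (R'.d 0))
    (fun x => by rw [ContinuousLinearMap.comp_apply, hg0, R'.ε_d])
  -- The degree-zero part of a chain homotopy from `f ∘ g` to the identity, on the `R'` side only;
  -- no higher degrees are needed.
  obtain ⟨k, hk⟩ := lift₁ _ (R'.projective 0) R' (ContinuousLinearMap.id _ _ - f0.comp g0)
    (fun x => by simp [hf0, hg0])
  have comm : ∀ (R R' : ProjectiveResolution M) (f0 : R.P 0 →L[Aᵐᵒᵖ] R'.P 0)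
      (f1 : R.P 1 →L[Aᵐᵒᵖ] R'.P 1) (_ : ∀ x, R'.d 0 (f1 x) = f0.comp (R.d 0) x) (t),
      R'.tensorD N 0 (tensorRight N f1 t) = tensorRight N f0 (R.tensorD N 0 t) :=
    fun R R' f0 f1 hf t => by
      have : (R'.tensorD N 0).comp (tensorRight N f1) = (tensorRight N f0).comp (R.tensorD N 0) :=
        ModTensor.ext fun x n => by
          change R'.tensorD N 0 (tensorRight N f1 (ModTensor.mk A (R.P 1) N x n))
            = tensorRight N f0 (R.tensorD N 0 (ModTensor.mk A (R.P 1) N x n))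
          rw [tensorRight_mk, tensorD_zero_mk, tensorD_zero_mk, tensorRight_mk, hf]
          rfl
      exact congrArg (fun k => k t) this
  have ef := comm R R' f0 f1 hf1
  have eg := comm R' R g0 g1 hg1
  have ek : ∀ t, R'.tensorD N 0 (tensorRight N k t) = t - tensorRight N f0 (tensorRight N g0 t) := by
    have : (R'.tensorD N 0).comp (tensorRight N k)
        = ContinuousLinearMap.id ℂ _ - (tensorRight N f0).comp (tensorRight N g0) :=
      ModTensor.ext fun x n => by
        change R'.tensorD N 0 (tensorRight N k (ModTensor.mk A (R'.P 0) N x n)) = _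
        rw [tensorRight_mk, tensorD_zero_mk, hk]
        simp
    exact fun t => congrArg (fun k => k t) this
  -- Exhibiting one range as a continuous preimage of the other transports closedness at once.
  have : Set.range (R'.tensorD N 0) = tensorRight N g0 ⁻¹' Set.range (R.tensorD N 0) := by
    ext t
    constructor
    · rintro ⟨y, rfl⟩
      exact ⟨_, eg y⟩
    · rintro ⟨y, hy⟩
      -- The homotopy gives `t = d'(k t) + f0 (g0 t)`; here `g0 t = d y`, and `f0 (d y) = d'(f1 y)`.
      refine ⟨tensorRight N k t + tensorRight N f1 y, ?_⟩
      rw [map_add, ek, ef, hy, sub_add_cancel]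
  rw [this]
  exact h.preimage (tensorRight N g0).continuous

end Comparison

/-! ### The isomorphism `(E ⊗̂ A) ⊗̂_A N ≅ E ⊗̂ N`. -/

section FreeTensor

universe v

variable {A : Type u} [Ring A] [Algebra ℂ A] [TopologicalSpace A] [FrechetAlgebra A]
variable (E : Type*) [AddCommGroup E] [Module ℂ E] [TopologicalSpace E] [FrechetSpace E]
variable (N : Type v) [AddCommGroup N] [Module ℂ N] [TopologicalSpace N] [FrechetSpace N]
  [Module A N] [FrechetModule A N]

/-- The map `(E ⊗̂ A) ⊗̂_A N → E ⊗̂ N`, `(e ⊗ a) ⊗ n ↦ e ⊗ a·n`. -/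
def freeTensor : ModTensor A (CTensor E A) N →L[ℂ] CTensor E N :=
  ModTensor.lift ((CTensor.mk (CTensor E A) N).compr₂ (innerAct A E N).toLinearMap)
    ((innerAct A E N).continuous.comp (CTensor.continuous_mk _ N))
    (fun t a n => by
      have : (innerAct A E N).comp ((CTensor.mkR n).comp (act (op a)))
          = (innerAct A E N).comp (CTensor.mkR (a • n)) := CTensor.ext fun e b => by
        change innerAct A E N (CTensor.mk _ N (op a • CTensor.mk E A e b) n)
          = innerAct A E N (CTensor.mk _ N (CTensor.mk E A e b) (a • n))
        rw [CTensor.op_smul_mk, innerAct_mk, innerAct_mk, op_smul_eq_mul, mul_smul]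
      exact congrArg (fun k => k t) this)

theorem freeTensor_mk (t : CTensor E A) (n : N) :
    freeTensor E N (ModTensor.mk A _ N t n) = innerAct A E N (CTensor.mk _ N t n) :=
  ModTensor.lift_mk _ _ _ t n

/-- The inverse map `E ⊗̂ N → (E ⊗̂ A) ⊗̂_A N`, `e ⊗ n ↦ (e ⊗ 1) ⊗ n`. -/
def freeTensorInv : CTensor E N →L[ℂ] ModTensor A (CTensor E A) N :=
  (ModTensor.π A (CTensor E A) N).comp
    (CTensor.map (CTensor.mkR (1 : A)) (ContinuousLinearMap.id ℂ N))

theorem freeTensorInv_mk (e : E) (n : N) : freeTensorInv (A := A) E N (CTensor.mk E N e n)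
    = ModTensor.mk A _ N (CTensor.mk E A e 1) n := by
  simp only [freeTensorInv, ContinuousLinearMap.comp_apply, CTensor.map_mk]
  rfl

theorem freeTensor_freeTensorInv (t : CTensor E N) :
    freeTensor E N (freeTensorInv (A := A) E N t) = t := by
  have : (freeTensor E N).comp (freeTensorInv (A := A) E N) = ContinuousLinearMap.id ℂ _ :=
    CTensor.ext fun e n => by simp [freeTensorInv_mk, freeTensor_mk]
  exact congrArg (fun k => k t) this

/-- Over `A`, `(e ⊗ 1) ⊗ a·n = (e ⊗ 1)·a ⊗ n = (e ⊗ a) ⊗ n`. The identity is tested before passing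
to the quotient, where triple elementary tensors suffice. -/
theorem freeTensorInv_freeTensor (t : ModTensor A (CTensor E A) N) :
    freeTensorInv (A := A) E N (freeTensor E N t) = t := by
  have : ((freeTensorInv (A := A) E N).comp ((freeTensor E N).comp (ModTensor.π A _ N)))
      = ModTensor.π A _ N := CTensor.ext_left fun e a n => by
    change freeTensorInv (A := A) E N (freeTensor E N (ModTensor.mk A _ N (CTensor.mk E A e a) n))
      = ModTensor.mk A _ N (CTensor.mk E A e a) n
    rw [freeTensor_mk, innerAct_mk, freeTensorInv_mk, ← ModTensor.mk_smul, CTensor.op_smul_mk]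
    simp
  obtain ⟨t, rfl⟩ := ModTensor.π_surjective A _ N t
  exact congrArg (fun k => k t) this

end FreeTensor

/-! ### `Tor₀` through the bar differential. -/

section FreeTor

universe v

variable {A : Type u} [Ring A] [Algebra ℂ A] [TopologicalSpace A] [FrechetAlgebra A]
variable (M : RightMod A)
variable (N : Type v) [AddCommGroup N] [Module ℂ N] [TopologicalSpace N] [FrechetSpace N]
  [Module A N] [FrechetModule A N]

/-- The first differential of the canonical resolution starts from the free module on the syzygy,
not on `M ⊗̂ A`. The two maps thus have different sources, and only their ranges are compared. -/
theorem range_freeTensor_comp_tensorD :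
    Set.range (fun t => freeTensor M N ((freeResolution M).tensorD N 0 t))
      = Set.range (barD A M N) := by
  -- The syzygy is a linear direct summand of `M ⊗̂ A`; projecting onto it and tensoring with `N`
  -- reaches all of `P₁ ⊗̂_A N`.
  let q : CTensor (CTensor M A) N →L[ℂ] ModTensor A (CTensor (syzygy M) A) N :=
    (freeTensorInv (A := A) (syzygy M) N).comp
      (CTensor.map (syzygyProj M) (ContinuousLinearMap.id ℂ N))
  have hq : Function.Surjective q := by
    intro t
    refine ⟨CTensor.map ((syzygyIncl M).restrictScalars ℂ) (ContinuousLinearMap.id ℂ N)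
      (freeTensor _ N t), ?_⟩
    have : (CTensor.map (syzygyProj M) (ContinuousLinearMap.id ℂ N)).comp
        (CTensor.map ((syzygyIncl M).restrictScalars ℂ) (ContinuousLinearMap.id ℂ N))
        = ContinuousLinearMap.id ℂ (CTensor (syzygy M) N) := CTensor.ext fun k n => by
      refine (congrArg _ (CTensor.map_mk _ _ _ _)).trans ((CTensor.map_mk _ _ _ _).trans ?_)
      change CTensor.mk _ N (syzygyProj M (syzygyIncl M k)) n = CTensor.mk _ N k n
      rw [syzygyProj_incl]
    refine (congrArg (fun k => freeTensorInv (A := A) (syzygy M) N (k (freeTensor _ N t)))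
      this).trans (freeTensorInv_freeTensor _ N t)
  -- The projection sends `m ⊗ a` to `m ⊗ a - m·a ⊗ 1`, which becomes `m ⊗ a·n - m·a ⊗ n`: the bar
  -- differential with the opposite sign.
  have hd : ∀ t, freeTensor M N ((freeResolution M).tensorD N 0 (q t)) = - barD A M N t := by
    have : (freeTensor M N).comp (((freeResolution M).tensorD N 0).comp q) = - barD A M N :=
      CTensor.ext_left fun m a n => by
        have h1 : q (CTensor.mk _ N (CTensor.mk M A m a) n)
            = ModTensor.mk A _ N (freeUnit (syzygy M) (syzygyProj M (CTensor.mk M A m a))) n := by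
          refine (congrArg (freeTensorInv (A := A) (syzygy M) N) (CTensor.map_mk _ _ _ _)).trans ?_
          exact freeTensorInv_mk _ _ _ _
        have h2 : (freeResolution M).tensorD N 0
              (ModTensor.mk A _ N (freeUnit (syzygy M) (syzygyProj M (CTensor.mk M A m a))) n)
            = ModTensor.mk A (CTensor M A) N
                (CTensor.mk M A m a - CTensor.mk M A (op a • m) 1) n := by
          refine (ModTensor.map_mk _ _ _ _ _ _).trans ?_
          change ModTensor.mk A (CTensor M A) N (syzygyIncl M (freeCover (syzygy M)
            (freeUnit (syzygy M) (syzygyProj M (CTensor.mk M A m a))))) n = _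
          rw [freeCover_freeUnit, syzygyIncl_proj, freeCover_mk]
          rfl
        refine (congrArg (fun t => freeTensor M N ((freeResolution M).tensorD N 0 t)) h1).trans ?_
        refine (congrArg (freeTensor M N) h2).trans ?_
        simp [freeTensor_mk]
    exact fun t => congrArg (fun k => k t) this
  ext y
  constructor
  · rintro ⟨t, rfl⟩
    obtain ⟨t, rfl⟩ := hq t
    exact ⟨-t, by rw [map_neg]; exact (hd t).symm⟩
  · rintro ⟨t, rfl⟩
    exact ⟨q (-t), by simpa using hd (-t)⟩

/-- The free-module isomorphism is a homeomorphism in both directions, hence preserves and reflects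
closed subsets. -/
theorem isClosed_range_freeResolution_iff :
    IsClosed (Set.range ((freeResolution M).tensorD N 0)) ↔ IsClosed (Set.range (barD A M N)) := by
  let e : ModTensor A (CTensor M A) N ≃ₜ CTensor M N :=
    { toFun := freeTensor M N
      invFun := freeTensorInv (A := A) M N
      left_inv := freeTensorInv_freeTensor M N
      right_inv := freeTensor_freeTensorInv M N
      continuous_toFun := (freeTensor M N).continuous
      continuous_invFun := (freeTensorInv (A := A) M N).continuous }
  rw [← range_freeTensor_comp_tensorD]
  have : Set.range (fun t => freeTensor M N ((freeResolution M).tensorD N 0 t))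
      = e '' Set.range ((freeResolution M).tensorD N 0) := Set.range_comp _ _
  rw [this]
  exact e.isClosed_image.symm

/-- `M` and `N` are `0`-transversal if and only if the bar differential has closed range. -/
theorem isTransversal_zero_iff : IsTransversal 0 M N ↔ IsClosed (Set.range (barD A M N)) := by
  rw [← isClosed_range_freeResolution_iff]
  constructor
  · rintro ⟨R, -, h⟩
    exact R.isClosed_range_tensorD N _ ((R.t2Space_tor_zero_iff N).1 h)
  · intro h
    -- The vanishing condition runs over `1 ≤ m ≤ 0` and is vacuous.
    exact ⟨freeResolution M, fun m h1 h2 => by omega,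
      ((freeResolution M).t2Space_tor_zero_iff N).2 h⟩

end FreeTor

/-! ### Square-zero extensions and derivations. -/

section SquareZero

/-- Supplies the Fréchet space underlying a square-zero extension, which is `B × Q`. -/
instance FrechetSpace.prod {E F : Type*} [AddCommGroup E] [Module ℂ E] [TopologicalSpace E]
    [FrechetSpace E] [AddCommGroup F] [Module ℂ F] [TopologicalSpace F] [FrechetSpace F] :
    FrechetSpace (E × F) := by
  let _ : UniformSpace E := IsTopologicalAddGroup.rightUniformSpace E
  have : IsUniformAddGroup E := isUniformAddGroup_of_addCommGroup
  have : CompleteSpace E := FrechetSpace.complete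
  have : (uniformity E).IsCountablyGenerated := IsUniformAddGroup.uniformity_countably_generated
  let _ : UniformSpace F := IsTopologicalAddGroup.rightUniformSpace F
  have : IsUniformAddGroup F := isUniformAddGroup_of_addCommGroup
  have : CompleteSpace F := FrechetSpace.complete
  have : (uniformity F).IsCountablyGenerated := IsUniformAddGroup.uniformity_countably_generated
  have : LocallyConvexSpace ℝ (E × F) :=
    .inf (.induced (LinearMap.fst ℝ E F)) (.induced (LinearMap.snd ℝ E F))
  exact FrechetSpace.of_uniform

variable {B : Type*} [Ring B] [Algebra ℂ B] [TopologicalSpace B] [FrechetAlgebra B]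
variable {Q : Type*} [AddCommGroup Q] [Module ℂ Q] [TopologicalSpace Q] [FrechetSpace Q]
  [Module B Q] [Module Bᵐᵒᵖ Q] [FrechetModule B Q] [FrechetModule Bᵐᵒᵖ Q] [SMulCommClass B Bᵐᵒᵖ Q]

instance : FrechetAlgebra (TrivSqZeroExt B Q) where
  __ := (inferInstanceAs (FrechetSpace (B × Q)) : FrechetSpace (TrivSqZeroExt B Q))
  continuous_mul := continuous_mul

/-- The homomorphism `b ↦ (b, 0)` into the square-zero extension. -/
def sqZeroInl : B →A[ℂ] TrivSqZeroExt B Q :=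
  ⟨TrivSqZeroExt.inlAlgHom ℂ B Q, TrivSqZeroExt.continuous_inl⟩

/-- The homomorphism `b ↦ (b, D b)` into the square-zero extension, for a derivation `D`. -/
def sqZeroDer (D : B →L[ℂ] Q) (hD : ∀ b c, D (b * c) = b • D c + op c • D b) :
    B →A[ℂ] TrivSqZeroExt B Q where
  toAlgHom := AlgHom.ofLinearMap
    ((TrivSqZeroExt.inlAlgHom ℂ B Q).toLinearMap + (TrivSqZeroExt.inrHom B Q).restrictScalars ℂ
      ∘ₗ D.toLinearMap)
    (by
      -- The Leibniz rule at `1 * 1` reads `D 1 = D 1 + D 1`; this makes the homomorphism unital.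
      have : D 1 = 0 := by simpa using hD 1 1
      ext <;> simp [this])
    (fun b c => by ext <;> simp [hD])
  cont := TrivSqZeroExt.continuous_inl.add (TrivSqZeroExt.continuous_inr.comp D.continuous)

theorem snd_sqZeroDer (D : B →L[ℂ] Q) (hD : ∀ b c, D (b * c) = b • D c + op c • D b) (b : B) :
    (sqZeroDer D hD b).snd = D b := by
  change (TrivSqZeroExt.inl b + TrivSqZeroExt.inr (D b)).snd = _
  simp

theorem fst_sqZeroDer (D : B →L[ℂ] Q) (hD : ∀ b c, D (b * c) = b • D c + op c • D b) (b : B) :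
    (sqZeroDer D hD b).fst = b := by
  change (TrivSqZeroExt.inl b + TrivSqZeroExt.inr (D b)).fst = _
  simp

end SquareZero

section Derivation

variable (B : Type*) [Ring B] [Algebra ℂ B] [TopologicalSpace B] [FrechetAlgebra B]

/-- The universal derivation `b ↦ 1 ⊗ b - b ⊗ 1`. -/
def Forms.der : B →L[ℂ] Forms B :=
  (CTensor.mkL (1 : B) - CTensor.mkR (1 : B)).codRestrict (formsSubmodule B) (fun b => by
    change mulMap B _ = 0
    simp)

variable {B}

theorem Forms.incl_der (b : B) :
    Forms.incl B (Forms.der B b) = CTensor.mk B B 1 b - CTensor.mk B B b 1 := rfl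

/-- After both actions are expanded, the mixed terms `b ⊗ c` cancel. -/
theorem Forms.der_mul (b c : B) :
    Forms.der B (b * c) = b • Forms.der B c + op c • Forms.der B b :=
  Forms.ext (by simp [Forms.incl_der, Forms.incl_smul, Forms.incl_op_smul])

end Derivation

/-! ### The closure of the range of `d_φ`, and forms modulo it. -/

section Relations

variable {A B : Type*} [Ring A] [Algebra ℂ A] [TopologicalSpace A] [FrechetAlgebra A]
  [Ring B] [Algebra ℂ B] [TopologicalSpace B] [FrechetAlgebra B] (φ : A →A[ℂ] B)

/-- The closure of the range of `d_φ`. -/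
def closedRelations : Submodule ℂ (CTensor B B) :=
  (LinearMap.range (dHom φ).toLinearMap).topologicalClosure

theorem isClosed_closedRelations : IsClosed (closedRelations φ : Set (CTensor B B)) :=
  Submodule.isClosed_topologicalClosure _

theorem dHom_mem_closedRelations (t : CTensor B (CTensor A B)) : dHom φ t ∈ closedRelations φ :=
  Submodule.le_topologicalClosure _ ⟨t, rfl⟩

variable {φ} in
theorem closedRelations_le {S : Submodule ℂ (CTensor B B)} (hS : IsClosed (S : Set (CTensor B B)))
    (h : ∀ t, dHom φ t ∈ S) : closedRelations φ ≤ S :=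
  Submodule.topologicalClosure_minimal _ (by rintro _ ⟨t, rfl⟩; exact h t) hS

theorem mulMap_dHom (t : CTensor B (CTensor A B)) : mulMap B (dHom φ t) = 0 := by
  have : (mulMap B).comp (dHom φ) = 0 := CTensor.ext_right fun b a c => by
    simp [dHom_mk, mul_assoc]
  exact congrArg (fun k => k t) this

theorem closedRelations_le_formsSubmodule : closedRelations φ ≤ formsSubmodule B :=
  closedRelations_le (inferInstance : IsClosed (formsSubmodule B : Set (CTensor B B)))
    (mulMap_dHom φ)

/-- `d_φ` commutes with left multiplication on the outer factor, and continuity passes stability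
from the range to its closure. With the right-hand analogue below, this makes `RelForms φ` a
`B`-bimodule. -/
theorem actFst_mem_closedRelations (b : B) {t : CTensor B B} (ht : t ∈ closedRelations φ) :
    CTensor.actFst B B B b t ∈ closedRelations φ := by
  have h : closedRelations φ ≤ (closedRelations φ).comap (CTensor.actFst B B B b) := by
    refine closedRelations_le
      ((isClosed_closedRelations φ).preimage (CTensor.continuous_actFst_right b)) fun t => ?_
    have : (CTensor.map (act b) (ContinuousLinearMap.id ℂ B)).comp (dHom φ)
        = (dHom φ).comp (CTensor.map (act b) (ContinuousLinearMap.id ℂ (CTensor A B))) :=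
      CTensor.ext_right fun x y z => by
        simp [dHom_mk, mul_assoc]
    have h' : CTensor.actFst B B B b (dHom φ t) = dHom φ _ := congrArg (fun k => k t) this
    change CTensor.actFst B B B b (dHom φ t) ∈ closedRelations φ
    rw [h']
    exact dHom_mem_closedRelations φ _
  exact h ht

theorem actSnd_mem_closedRelations (b : Bᵐᵒᵖ) {t : CTensor B B} (ht : t ∈ closedRelations φ) :
    CTensor.actSnd Bᵐᵒᵖ B B b t ∈ closedRelations φ := by
  have h : closedRelations φ ≤ (closedRelations φ).comap (CTensor.actSnd Bᵐᵒᵖ B B b) := by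
    refine closedRelations_le
      ((isClosed_closedRelations φ).preimage (CTensor.continuous_actSnd_right b)) fun t => ?_
    have : (CTensor.map (ContinuousLinearMap.id ℂ B) (act b)).comp (dHom φ)
        = (dHom φ).comp (CTensor.map (ContinuousLinearMap.id ℂ B)
            (CTensor.map (ContinuousLinearMap.id ℂ A) (act b))) :=
      CTensor.ext_right fun x y z => by
        simp [dHom_mk, mul_assoc]
    have h' : CTensor.actSnd Bᵐᵒᵖ B B b (dHom φ t) = dHom φ _ := congrArg (fun k => k t) this
    change CTensor.actSnd Bᵐᵒᵖ B B b (dHom φ t) ∈ closedRelations φ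
    rw [h']
    exact dHom_mem_closedRelations φ _
  exact h ht

/-- The differential forms lying in the closure of the range of `d_φ`. -/
def closedFormRelations : Submodule ℂ (Forms B) :=
  (closedRelations φ).comap (Forms.incl B).toLinearMap

instance : IsClosed (closedFormRelations φ : Set (Forms B)) :=
  (isClosed_closedRelations φ).preimage (Forms.incl B).continuous

/-- The Hausdorff module of relative differential forms of `B` over `A`. -/
def RelForms : Type _ := Forms B ⧸ closedFormRelations φ

instance : AddCommGroup (RelForms φ) :=
  inferInstanceAs (AddCommGroup (Forms B ⧸ closedFormRelations φ))
instance : Module ℂ (RelForms φ) := inferInstanceAs (Module ℂ (Forms B ⧸ closedFormRelations φ))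
instance : TopologicalSpace (RelForms φ) :=
  inferInstanceAs (TopologicalSpace (Forms B ⧸ closedFormRelations φ))
instance : FrechetSpace (RelForms φ) :=
  inferInstanceAs (FrechetSpace (Forms B ⧸ closedFormRelations φ))

/-- The quotient map `Ω¹B → Ω¹B / closure`. -/
def RelForms.π : Forms B →L[ℂ] RelForms φ := ⟨(closedFormRelations φ).mkQ, continuous_quot_mk⟩

theorem RelForms.π_surjective : Function.Surjective (RelForms.π φ) := Submodule.mkQ_surjective _

theorem RelForms.isOpenQuotientMap_π : IsOpenQuotientMap (RelForms.π φ) :=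
  (closedFormRelations φ).isOpenQuotientMap_mkQ

theorem RelForms.π_eq_zero_iff (w : Forms B) :
    RelForms.π φ w = 0 ↔ Forms.incl B w ∈ closedRelations φ :=
  Submodule.Quotient.mk_eq_zero _

instance : SMul B (RelForms φ) where
  smul b := (closedFormRelations φ).mapQ (closedFormRelations φ) (act b).toLinearMap
    (fun _ h => actFst_mem_closedRelations φ b h)

instance : SMul Bᵐᵒᵖ (RelForms φ) where
  smul b := (closedFormRelations φ).mapQ (closedFormRelations φ) (act b).toLinearMap
    (fun _ h => actSnd_mem_closedRelations φ b h)

theorem RelForms.smul_π (b : B) (w : Forms B) : b • RelForms.π φ w = RelForms.π φ (b • w) := rfl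

theorem RelForms.op_smul_π (b : Bᵐᵒᵖ) (w : Forms B) :
    b • RelForms.π φ w = RelForms.π φ (b • w) := rfl

instance : Module B (RelForms φ) :=
  (RelForms.π_surjective φ).module B (RelForms.π φ : Forms B →+ RelForms φ) fun _ _ => rfl

instance : Module Bᵐᵒᵖ (RelForms φ) :=
  (RelForms.π_surjective φ).module Bᵐᵒᵖ (RelForms.π φ : Forms B →+ RelForms φ) fun _ _ => rfl

instance : SMulCommClass B Bᵐᵒᵖ (RelForms φ) where
  smul_comm a b w := by
    obtain ⟨w, rfl⟩ := RelForms.π_surjective φ w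
    simp only [RelForms.smul_π, RelForms.op_smul_π, smul_comm]

/-- Joint continuity descends from `Ω¹B` because the product of the identity with the open quotient
map `RelForms.π φ` is again an open quotient map. -/
instance : FrechetModule B (RelForms φ) where
  smul_assoc c a w := by
    obtain ⟨w, rfl⟩ := RelForms.π_surjective φ w
    simp only [RelForms.smul_π, smul_assoc, _root_.map_smul]
  continuous_smul := by
    rw [← (IsOpenQuotientMap.id.prodMap (RelForms.isOpenQuotientMap_π φ)).continuous_comp_iff]
    exact (RelForms.π φ).continuous.comp (continuous_smul (M := B) (X := Forms B))

instance : FrechetModule Bᵐᵒᵖ (RelForms φ) where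
  smul_assoc c a w := by
    obtain ⟨w, rfl⟩ := RelForms.π_surjective φ w
    simp only [RelForms.op_smul_π, smul_assoc, _root_.map_smul]
  continuous_smul := by
    rw [← (IsOpenQuotientMap.id.prodMap (RelForms.isOpenQuotientMap_π φ)).continuous_comp_iff]
    exact (RelForms.π φ).continuous.comp (continuous_smul (M := Bᵐᵒᵖ) (X := Forms B))

end Relations

/-! ### Epimorphisms and density of the range of `d_φ` in `Ω¹B`. -/

section Epimorphism

variable {A B : Type u} [Ring A] [Algebra ℂ A] [TopologicalSpace A] [FrechetAlgebra A]
  [Ring B] [Algebra ℂ B] [TopologicalSpace B] [FrechetAlgebra B] (φ : A →A[ℂ] B)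

/-- A derivation of `B` vanishing on `φ(A)` gives a homomorphism into a square-zero extension
agreeing with `sqZeroInl` on `φ(A)`, so an epimorphism forces it to be zero. The test derivation is
the universal one with values in `RelForms φ`. -/
theorem formsSubmodule_le_of_isEpimorphism (h : IsEpimorphism φ) :
    formsSubmodule B ≤ closedRelations φ := by
  have hD : ∀ b c, ((RelForms.π φ).comp (Forms.der B)) (b * c)
      = b • ((RelForms.π φ).comp (Forms.der B)) c + op c • ((RelForms.π φ).comp (Forms.der B)) b :=
    fun b c => by
      simp only [ContinuousLinearMap.comp_apply, Forms.der_mul, map_add, RelForms.smul_π,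
        RelForms.op_smul_π]
  have hd : ∀ b, CTensor.mk B B b 1 - CTensor.mk B B 1 b ∈ closedRelations φ := by
    have h1 := h (TrivSqZeroExt B (RelForms φ)) sqZeroInl (sqZeroDer _ hD) (by
      ext a
      · change φ a = (sqZeroDer _ hD (φ a)).fst
        rw [fst_sqZeroDer]
      · change (0 : RelForms φ) = (sqZeroDer _ hD (φ a)).snd
        rw [snd_sqZeroDer, eq_comm]
        -- The form attached to `φ a` is `-d_φ(1 ⊗ a ⊗ 1)`, hence a relation.
        refine (RelForms.π_eq_zero_iff φ _).2 ?_
        change CTensor.mk B B 1 (φ a) - CTensor.mk B B (φ a) 1 ∈ _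
        rw [← neg_sub]
        refine neg_mem ?_
        simpa [dHom_mk] using
          dHom_mem_closedRelations φ (CTensor.mk B _ 1 (CTensor.mk A B a 1)))
    intro b
    have h2 : (0 : RelForms φ) = (sqZeroDer _ hD b).snd :=
      congrArg (fun ψ : B →A[ℂ] TrivSqZeroExt B (RelForms φ) => (ψ b).snd) h1
    rw [snd_sqZeroDer] at h2
    rw [← neg_sub]
    exact neg_mem ((RelForms.π_eq_zero_iff φ _).1 h2.symm)
  -- Multiplying `hd c` by `b` on the left gives `b ⊗ c ≡ bc ⊗ 1`, so every tensor is congruent to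
  -- `μ_B(t) ⊗ 1`, which vanishes on `Ω¹B`.
  have key : ∀ t : CTensor B B, t - CTensor.mk B B (mulMap B t) 1 ∈ closedRelations φ := by
    let f : CTensor B B →L[ℂ] CTensor B B ⧸ closedRelations φ :=
      ⟨(closedRelations φ).mkQ, continuous_quot_mk⟩
    -- Closedness makes the quotient Hausdorff, so that `CTensor.ext` applies to maps into it.
    have : IsClosed (closedRelations φ : Set (CTensor B B)) := isClosed_closedRelations φ
    have h0 : f.comp (ContinuousLinearMap.id ℂ _ - (CTensor.mkR (1 : B)).comp (mulMap B)) = 0 :=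
      CTensor.ext fun b c => by
        refine (Submodule.Quotient.mk_eq_zero _).2 ?_
        have := actFst_mem_closedRelations φ b (neg_mem (hd c))
        simpa using this
    exact fun t => (Submodule.Quotient.mk_eq_zero _).1 (congrArg (fun k => k t) h0)
  intro t ht
  have ht' : mulMap B t = 0 := ht
  simpa [ht'] using key t

/-- When `ψ` and `ψ'` agree on `φ(A)`, the continuous map `b ⊗ c ↦ ψ(b)ψ'(c)` annihilates the
relations, and with them `1 ⊗ b - b ⊗ 1`, on which its value is `ψ'(b) - ψ(b)`. -/
theorem isEpimorphism_of_formsSubmodule_le (h : formsSubmodule B ≤ closedRelations φ) :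
    IsEpimorphism φ := by
  intro C _ _ _ _ ψ ψ' hψ
  let f : CTensor B B →L[ℂ] C := (mulMap C).comp (CTensor.map (homL ψ) (homL ψ'))
  have hf : closedRelations φ ≤ LinearMap.ker f.toLinearMap := by
    refine closedRelations_le (isClosed_singleton.preimage f.continuous) fun t => ?_
    have : f.comp (dHom φ) = 0 := CTensor.ext_right fun b a c => by
      have ha : ψ' (φ a) = ψ (φ a) := (congrArg (fun k : A →A[ℂ] C => k a) hψ).symm
      simp [f, dHom_mk, mul_assoc, ha]
    exact congrArg (fun k => k t) this
  ext b
  have h1 : f (Forms.incl B (Forms.der B b)) = 0 := hf (h (Forms.mulMap_incl _))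
  rw [Forms.incl_der, map_sub] at h1
  have h2 : f (CTensor.mk B B 1 b) = ψ' b := by simp [f]
  have h3 : f (CTensor.mk B B b 1) = ψ b := by simp [f]
  rw [h2, h3, sub_eq_zero] at h1
  exact h1.symm

/-- `φ` is an epimorphism if and only if the range of `d_φ` is dense in `Ω¹B`. -/
theorem isEpimorphism_iff : IsEpimorphism φ ↔ formsSubmodule B ≤ closedRelations φ :=
  ⟨formsSubmodule_le_of_isEpimorphism φ, isEpimorphism_of_formsSubmodule_le φ⟩

end Epimorphism

/-! ### The range of the comparison map equals the range of `d_φ`. -/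

section Comparison

variable {A B : Type*} [Ring A] [Algebra ℂ A] [TopologicalSpace A] [FrechetAlgebra A]
  [Ring B] [Algebra ℂ B] [TopologicalSpace B] [FrechetAlgebra B] (φ : A →A[ℂ] B)

/-- The map `B ⊗̂_A Ω¹A → B ⊗̂ A`, `b ⊗ ∑ aᵢ ⊗ aᵢ' ↦ ∑ bφ(aᵢ) ⊗ aᵢ'`. -/
def inducedFormsIncl : ModTensor A (Restrict φ) (Forms A) →L[ℂ] CTensor B A :=
  ModTensor.lift
    ((CTensor.actFst B B A).compl₁₂ (Restrict.val φ).toLinearMap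
      ((CTensor.map (homL φ) (ContinuousLinearMap.id ℂ A)).comp (Forms.incl A)).toLinearMap)
    ((CTensor.continuous_actFst (A := B) (M := B) (N := A)).comp
      (f := fun p : Restrict φ × Forms A => (Restrict.val φ p.1,
        CTensor.map (homL φ) (ContinuousLinearMap.id ℂ A) (Forms.incl A p.2))) (by fun_prop))
    (fun b a w => by
      have : (CTensor.map (act (Restrict.val φ b * φ a)) (ContinuousLinearMap.id ℂ A)).comp
            (CTensor.map (homL φ) (ContinuousLinearMap.id ℂ A))
          = ((CTensor.map (act (Restrict.val φ b)) (ContinuousLinearMap.id ℂ A)).comp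
            (CTensor.map (homL φ) (ContinuousLinearMap.id ℂ A))).comp
            (CTensor.map (act a) (ContinuousLinearMap.id ℂ A)) :=
        CTensor.ext fun x y => by simp [mul_assoc]
      exact congrArg (fun k => k (Forms.incl A w)) this)

theorem inducedFormsIncl_mk (b : Restrict φ) (w : Forms A) :
    inducedFormsIncl φ (ModTensor.mk A _ _ b w)
      = CTensor.actFst B B A (Restrict.val φ b)
          (CTensor.map (homL φ) (ContinuousLinearMap.id ℂ A) (Forms.incl A w)) :=
  ModTensor.lift_mk _ _ _ b w

/-- For a form `∑ x ⊗ y` one has `∑ xy = 0`, so in `∑ d_φ(bφ(x) ⊗ y ⊗ c)` the terms `bφ(xy) ⊗ c` sum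
to zero and `-∑ bφ(x) ⊗ φ(y)c` remains. -/
theorem incl_formsComparison_π (t : CTensor (ModTensor A (Restrict φ) (Forms A)) (Restrict φ)) :
    Forms.incl B (formsComparison φ (ModTensor.π A _ _ t))
      = - dHom φ (CTensor.assoc B A B
          (CTensor.map (inducedFormsIncl φ) (Restrict.val φ) t)) := by
  have h : (Forms.incl B).comp ((formsComparison φ).comp (ModTensor.π A _ _))
      = - (dHom φ).comp ((CTensor.assoc B A B).comp
          (CTensor.map (inducedFormsIncl φ) (Restrict.val φ))) := by
    refine CTensor.ext fun s c => ?_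
    have h1 : ((Forms.incl B).comp ((formsComparison φ).comp (ModTensor.π A _ _))).comp
        (CTensor.mkR c)
      = (- (dHom φ).comp ((CTensor.assoc B A B).comp
          (CTensor.map (inducedFormsIncl φ) (Restrict.val φ)))).comp (CTensor.mkR c) := by
      refine ModTensor.ext fun b w => ?_
      change Forms.incl B (formsComparison φ (ModTensor.mk A _ _ (ModTensor.mk A _ _ b w) c))
        = - dHom φ (CTensor.assoc B A B (CTensor.map (inducedFormsIncl φ) (Restrict.val φ)
            (CTensor.mk _ _ (ModTensor.mk A _ _ b w) c)))
      rw [formsComparison_mk, CTensor.map_mk, inducedFormsIncl_mk, Forms.incl_op_smul,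
        Forms.incl_smul, Forms.incl_map]
      set b' := Restrict.val φ b
      set c' := Restrict.val φ c
      -- On all of `A ⊗̂ A` the formula holds with the error term `b'φ(xy) ⊗ c'`. Stating it there
      -- allows a check on elementary tensors; the error vanishes on `Ω¹A`.
      have h2 : ((CTensor.map (ContinuousLinearMap.id ℂ B) (act (op c'))).comp
            (CTensor.map (act b') (ContinuousLinearMap.id ℂ B))).comp
            (CTensor.map (homL φ) (homL φ))
          + (dHom φ).comp ((CTensor.assoc B A B).comp ((CTensor.mkR c').comp
            ((CTensor.map (act b') (ContinuousLinearMap.id ℂ A)).comp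
              (CTensor.map (homL φ) (ContinuousLinearMap.id ℂ A)))))
          = (CTensor.mkR c').comp ((act b').comp ((homL φ).comp (mulMap A))) :=
        CTensor.ext fun x y => by
          simp [dHom_mk, mul_assoc]
      have h3 := congrArg (fun k => k (Forms.incl A w)) h2
      refine eq_neg_of_add_eq_zero_left (Eq.trans h3 ?_)
      simp [Forms.mulMap_incl]
    exact congrArg (fun k => k s) h1
  exact congrArg (fun k => k t) h

/-- The identity map from `B` to `B`, viewed as an `A`-bimodule. -/
def Restrict.of : B →L[ℂ] Restrict φ := ContinuousLinearMap.id ℂ B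

theorem Restrict.val_of (b : B) : Restrict.val φ (Restrict.of φ b) = b := rfl

/-- The map `(B ⊗̂ A) ⊗̂ B → B ⊗̂_A Ω¹A ⊗̂_A B`, `(b ⊗ a) ⊗ c ↦ b ⊗ d(a) ⊗ c`. -/
def toInducedForms : CTensor (CTensor B A) B →L[ℂ] InducedForms φ :=
  (ModTensor.π A (ModTensor A (Restrict φ) (Forms A)) (Restrict φ)).comp
    (CTensor.map ((ModTensor.π A (Restrict φ) (Forms A)).comp
      (CTensor.map (Restrict.of φ) (Forms.der A))) (Restrict.of φ))

/-- The image of `b ⊗ da ⊗ c` is `b ⊗ φ(a)c - bφ(a) ⊗ c`. This shows that each value of `d_φ` comes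
from induced forms. -/
theorem incl_formsComparison_toInducedForms (t : CTensor (CTensor B A) B) :
    Forms.incl B (formsComparison φ (toInducedForms φ t)) = - dHom φ (CTensor.assoc B A B t) := by
  have : (Forms.incl B).comp ((formsComparison φ).comp (toInducedForms φ))
      = - (dHom φ).comp (CTensor.assoc B A B) := CTensor.ext_left fun b a c => by
    have h1 : toInducedForms φ (CTensor.mk _ B (CTensor.mk B A b a) c)
        = ModTensor.mk A _ (Restrict φ) (ModTensor.mk A (Restrict φ) (Forms A)
            (Restrict.of φ b) (Forms.der A a)) (Restrict.of φ c) := by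
      simp only [toInducedForms, ContinuousLinearMap.comp_apply, CTensor.map_mk]
      rfl
    change Forms.incl B (formsComparison φ (toInducedForms φ (CTensor.mk _ B (CTensor.mk B A b a) c)))
      = - dHom φ (CTensor.assoc B A B (CTensor.mk _ B (CTensor.mk B A b a) c))
    rw [h1, formsComparison_mk, Forms.incl_op_smul, Forms.incl_smul, Forms.incl_map,
      Forms.incl_der, CTensor.assoc_mk, dHom_mk, Restrict.val_of, Restrict.val_of]
    simp
  exact congrArg (fun k => k t) this

/-- The two preceding formulas give the two inclusions; signs and reassociation do not affect
ranges. -/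
theorem range_incl_formsComparison :
    Set.range (fun t => Forms.incl B (formsComparison φ t)) = Set.range (dHom φ) := by
  ext y
  constructor
  · rintro ⟨t, rfl⟩
    obtain ⟨t, rfl⟩ := ModTensor.π_surjective A _ _ t
    exact ⟨_, (map_neg (dHom φ) _).trans (incl_formsComparison_π φ t).symm⟩
  · rintro ⟨t, rfl⟩
    obtain ⟨t, rfl⟩ := CTensor.assoc_surjective t
    refine ⟨- toInducedForms φ t, ?_⟩
    simp only [map_neg, incl_formsComparison_toInducedForms, neg_neg]

theorem mulMap_surjective (B : Type*) [Ring B] [Algebra ℂ B] [TopologicalSpace B]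
    [FrechetAlgebra B] : Function.Surjective (mulMap B) :=
  fun b => ⟨CTensor.mk B B 1 b, by simp⟩

theorem exact_iff_range_eq :
    Function.Exact (dHom φ) (mulMap B) ↔ Set.range (dHom φ) = formsSubmodule B := by
  rw [Function.Exact, Set.ext_iff]
  exact forall_congr' fun _ => iff_comm

/-- `Forms.incl B` is injective with image `formsSubmodule B`, so surjectivity onto `Ω¹B` can be
tested on images in `B ⊗̂ B`. -/
theorem surjective_formsComparison_iff :
    Function.Surjective (formsComparison φ) ↔ Set.range (dHom φ) = formsSubmodule B := by
  have h : (formsSubmodule B : Set (CTensor B B)) = Forms.incl B '' Set.univ := by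
    rw [Set.image_univ]
    exact Subtype.range_coe.symm
  rw [← range_incl_formsComparison, h, ← Set.range_eq_univ,
    ← Forms.incl_injective.image_injective.eq_iff, ← Set.range_comp]
  rfl

/-- `Restrict φ` unfolds to `B` with `A` acting through `φ`, so the bar differential is literally
`d_φ` after reassociation. -/
theorem range_barD_restrict :
    (Set.range (barD A (Restrict φ) (Restrict φ)) : Set (CTensor B B)) = Set.range (dHom φ) := by
  have h : ∀ t : CTensor (CTensor B A) B,
      (barD A (Restrict φ) (Restrict φ) t : CTensor B B) = dHom φ (CTensor.assoc B A B t) := by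
    intro t
    have : (barD A (Restrict φ) (Restrict φ) : CTensor (CTensor B A) B →L[ℂ] CTensor B B)
        = (dHom φ).comp (CTensor.assoc B A B) := CTensor.ext_left fun b a c => by
      refine (barD_mk A (Restrict φ) (Restrict φ) b a c).trans ?_
      exact ((congrArg (dHom φ) (CTensor.assoc_mk (X := B) (Z := B) b a c)).trans
        (dHom_mk φ b a c)).symm
    exact congrArg (fun k => k t) this
  ext y
  constructor
  · rintro ⟨t, rfl⟩
    exact ⟨_, (h t).symm⟩
  · rintro ⟨t, rfl⟩
    obtain ⟨t, rfl⟩ := CTensor.assoc_surjective t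
    exact ⟨t, h t⟩

end Comparison

/-! ### Closed and dense range: the conclusion. -/

section Main

variable {A B : Type u} [Ring A] [Algebra ℂ A] [TopologicalSpace A] [FrechetAlgebra A]
  [Ring B] [Algebra ℂ B] [TopologicalSpace B] [FrechetAlgebra B] (φ : A →A[ℂ] B)

theorem isPseudoflat_zero_iff : IsPseudoflat 0 φ ↔ IsClosed (Set.range (dHom φ)) := by
  rw [← range_barD_restrict]
  exact isTransversal_zero_iff (RightMod.mk (A := A) (Restrict φ)) (Restrict φ)

/-- The range lies in the closed subspace `Ω¹B`; being closed and dense there is the same as being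
all of it. -/
theorem isPseudoflat_zero_and_isEpimorphism_iff :
    (IsPseudoflat 0 φ ∧ IsEpimorphism φ) ↔ Set.range (dHom φ) = formsSubmodule B := by
  rw [isPseudoflat_zero_iff, isEpimorphism_iff]
  have hcl : (closedRelations φ : Set (CTensor B B)) = closure (Set.range (dHom φ)) := rfl
  constructor
  · rintro ⟨h1, h2⟩
    rw [h1.closure_eq] at hcl
    rw [← hcl]
    exact congrArg _ ((closedRelations_le_formsSubmodule φ).antisymm h2)
  · intro h
    have h1 : IsClosed (Set.range (dHom φ)) := by
      rw [h]
      infer_instance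
    refine ⟨h1, ?_⟩
    rw [h1.closure_eq, h] at hcl
    exact hcl.ge

end Main

end Frechet

end

theorem mainTheorem4 {A B : Type u}
    [Ring A] [Algebra ℂ A] [TopologicalSpace A] [Frechet.FrechetAlgebra A]
    [Ring B] [Algebra ℂ B] [TopologicalSpace B] [Frechet.FrechetAlgebra B]
    (φ : A →A[ℂ] B) :
    ((Frechet.IsPseudoflat 0 φ ∧ Frechet.IsEpimorphism φ) ↔
      Function.Surjective (Frechet.formsComparison φ)) ∧
    ((Frechet.IsPseudoflat 0 φ ∧ Frechet.IsEpimorphism φ) ↔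
      Function.Surjective (Frechet.mulMap B) ∧
        Function.Exact (Frechet.dHom φ) (Frechet.mulMap B)) := by
  rw [Frechet.isPseudoflat_zero_and_isEpimorphism_iff, Frechet.surjective_formsComparison_iff,
    Frechet.exact_iff_range_eq]
  exact ⟨Iff.rfl, fun h => ⟨Frechet.mulMap_surjective B, h⟩, fun h => h.2⟩
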